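/- Let $A$ be a commutative ring and let $\mathbb{S}$ be the standard ring scheme over $A$ (so $\mathbb{S}(R)=R$ for every $A$-algebra $R$). Let $\mathcal{E}$ be a finite free $\mathbb{S}$-algebra scheme over $A$: a commutative ring scheme over $A$ together with a ring scheme morphism $s:\mathbb{S}\to\mathcal{E}$ and an isomorphism of $\mathbb{S}$-module schemes $\psi:\mathcal{E}\to\mathbb{S}^{\ell}$ for some $\ell\in\mathbb{N}$. Let $(k,e)$ be an $\mathcal{E}$-ring, that is, an $A$-algebra $k$ together with an $A$-algebra homomorphism $e:k\to\mathcal{E}(k)$, where $\mathcal{E}(k)$ is an $A$-algebra through the standard map $s^k:k\to\mathcal{E}(k)$. For a scheme $X$ over $k$, let $X\times_k\mathcal{E}^e(k)$ denote the base extension of $X$ along $e:k\to\mathcal{E}(k)$. The prolongation space $\tau(X)$ is the Weil restriction of $X\times_k\mathcal{E}^e(k)$ along $s^k$, when it exists: a scheme $\tau(X)$ over $k$ with an $\mathcal{E}(k)$-morphism $r_X:\tau(X)\times_{k,s^k}\mathcal{E}(k)\to X\times_k\mathcal{E}^e(k)$ such that, for every scheme $U$ over $k$, the map $p\mapsto r_X\circ(p\times\mathrm{id})$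 is a bijection from $\operatorname{Hom}_k(U,\tau(X))$ onto $\operatorname{Hom}_{\mathcal{E}(k)}(U\times_{k,s^k}\mathcal{E}(k),\,X\times_k\mathcal{E}^e(k))$. For a morphism $f:X\to Y$ of schemes over $k$ for which $\tau(X)$ and $\tau(Y)$ exist, $\tau(f):\tau(X)\to\tau(Y)$ is the unique $k$-morphism with $r_Y\circ(\tau(f)\times\mathrm{id})=(f\times_k\mathcal{E}^e(k))\circ r_X$. **Proposition.** Let $f:X\to Y$ be a morphism of schemes over $k$ such that $\tau(X)$ and $\tau(Y)$ exist. 1. If $f$ is étale, then $\tau(f):\tau(X)\to\tau(Y)$ is étale. 2. If $f$ is a closed embedding, then $\tau(f)$ is a closed embedding. 3. If $f$ is smooth, then $\tau(f)$ is smooth. In particular, if $X$ is a scheme over $k$ such that $\tau(X)$ exists and $X$ is smooth over $k$, then $\tau(X)$ is smooth over $k$. -/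

import Mathlib

open CategoryTheory Limits AlgebraicGeometry MonoidalCategory CartesianMonoidalCategory Opposite
open scoped CommRingObj

universe u

noncomputable section

namespace ERing

section RingObjects

open scoped MonObj AddMonObj

variable {C : Type*} [Category.{u} C] [CartesianMonoidalCategory C] [BraidedCategory C]

/-- The presheaf of additive groups underlying a presheaf of commutative rings. -/
abbrev additivePresheaf (F : Cᵒᵖ ⥤ CommRingCat.{u}) : Cᵒᵖ ⥤ AddGrpCat.{u} :=
  F ⋙ forget₂ CommRingCat RingCat ⋙ forget₂ RingCat AddCommGrpCat ⋙
    forget₂ AddCommGrpCat AddGrpCat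

/-- The presheaf of multiplicative monoids underlying a presheaf of commutative rings. -/
abbrev multiplicativePresheaf (F : Cᵒᵖ ⥤ CommRingCat.{u}) : Cᵒᵖ ⥤ CommMonCat.{u} :=
  F ⋙ forget₂ CommRingCat CommMonCat

/-- An object representing a presheaf of commutative rings is a commutative ring object. -/
@[reducible]
def commRingObjOfRepresentableBy (X : C) (F : Cᵒᵖ ⥤ CommRingCat.{u})
    (α : (F ⋙ forget CommRingCat).RepresentableBy X) : CommRingObj X :=
  letI iA : AddGrpObj X := AddGrpObj.ofRepresentableBy X (additivePresheaf F) α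
  letI iM : MonObj X :=
    MonObj.ofRepresentableBy X (multiplicativePresheaf F ⋙ forget₂ CommMonCat MonCat) α
  have hadd {U : C} (a b : U ⟶ X) :
      (α.homEquiv (a + b) : F.obj (op U)) = α.homEquiv a + α.homEquiv b :=
    ((yonedaAddMonObjIsoOfRepresentableBy X
      (additivePresheaf F ⋙ forget₂ AddGrpCat AddMonCat) α).hom.app (op U)).hom.map_add a b
  have hmul {U : C} (a b : U ⟶ X) :
      (α.homEquiv (a * b) : F.obj (op U)) = α.homEquiv a * α.homEquiv b :=
    ((yonedaMonObjIsoOfRepresentableBy X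
      (multiplicativePresheaf F ⋙ forget₂ CommMonCat MonCat) α).hom.app (op U)).hom.map_mul a b
  { __ := iA
    __ := iM
    __ := IsCommMonObj.ofRepresentableBy X (multiplicativePresheaf F) α
    add_comm := by
      have h : snd X X + fst X X = fst X X + snd X X := α.homEquiv.injective (by
        simp only [hadd]; exact add_comm _ _)
      rw [Hom.add_def, Hom.add_def, lift_fst_snd, Category.id_comp] at h
      rw [← h]
      congr 1
      ext <;> simp
    mul_add := (mul_add_iff X).2 fun U a b c ↦ α.homEquiv.injective (by
      simp only [hadd, hmul]; exact mul_add _ _ _)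
    add_mul := (add_mul_iff X).2 fun U a b c ↦ α.homEquiv.injective (by
      simp only [hadd, hmul]; exact add_mul _ _ _) }

/-- With the ring object structure of `commRingObjOfRepresentableBy`, the representing bijections
`Hom(U, X) ≃ F(U)` are ring isomorphisms. -/
def homRingEquivOfRepresentableBy (X : C) (F : Cᵒᵖ ⥤ CommRingCat.{u})
    (α : (F ⋙ forget CommRingCat).RepresentableBy X) (U : C) :
    letI := commRingObjOfRepresentableBy X F α
    (U ⟶ X) ≃+* F.obj (op U) :=
  letI := commRingObjOfRepresentableBy X F α
  { toEquiv := α.homEquiv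
    map_mul' a b := ((yonedaMonObjIsoOfRepresentableBy X
      (multiplicativePresheaf F ⋙ forget₂ CommMonCat MonCat) α).hom.app (op U)).hom.map_mul a b
    map_add' a b := ((yonedaAddMonObjIsoOfRepresentableBy X
      (additivePresheaf F ⋙ forget₂ AddGrpCat AddMonCat) α).hom.app (op U)).hom.map_add a b }

end RingObjects

section RingSchemes

/-- The presheaf of rings `U ↦ Γ(U, 𝒪_U)` on schemes over `B`. -/
def globalSections (B : Scheme.{u}) : (Over B)ᵒᵖ ⥤ CommRingCat.{u} :=
  (Over.forget B).op ⋙ Scheme.Γ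

/-- The affine line over `B`, the scheme underlying the standard ring scheme `𝕊`. -/
def standardRingScheme (B : Scheme.{u}) : Over B := Over.mk (𝔸(PUnit.{u + 1}; B) ↘ B)

/-- Morphisms over `B` from `U` to the affine line are the global functions on `U`. -/
def standardRepresentableBy (B : Scheme.{u}) :
    (globalSections B ⋙ forget CommRingCat).RepresentableBy (standardRingScheme B) where
  homEquiv {U} :=
    { toFun p := p.left.appTop (AffineSpace.coord B PUnit.unit)
      invFun a := Over.homMk (AffineSpace.homOfVector U.hom fun _ ↦ a)
        (AffineSpace.homOfVector_over _ _)
      left_inv p := by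
        ext1
        refine AffineSpace.hom_ext ?_ fun i ↦ ?_
        · exact (AffineSpace.homOfVector_over _ _).trans (Over.w p).symm
        · exact AffineSpace.homOfVector_appTop_coord _ _ _
      right_inv a := AffineSpace.homOfVector_appTop_coord _ _ _ }
  homEquiv_comp f g := by
    simp [globalSections]
    rfl

/-- The ring scheme structure of the standard ring scheme: addition and multiplication of
functions. -/
instance (B : Scheme.{u}) : CommRingObj (standardRingScheme B) :=
  commRingObjOfRepresentableBy _ _ (standardRepresentableBy B)

/-- `𝕊(U) = Γ(U, 𝒪_U)` as rings. -/
def standardPoints {B : Scheme.{u}} (U : Over B) : (U ⟶ standardRingScheme B) ≃+* Γ(U.left, ⊤) :=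
  homRingEquivOfRepresentableBy _ _ (standardRepresentableBy B) U

/-- A finite free `𝕊`-algebra scheme over the ring `A`: a ring scheme `E` over `A`, a morphism of
ring schemes `s : 𝕊 ⟶ E`, and an isomorphism of `𝕊`-module schemes `ψ : E ≅ 𝕊^ℓ`. The `𝕊`-module
structure on `E` is the one given by `s`, and linearity of `ψ` is expressed on `U`-points,
componentwise. -/
structure FiniteFreeAlgebraScheme (A : Type u) [CommRing A] where
  /-- the underlying scheme over `A` -/
  E : Over (Spec (.of A))
  [ring : CommRingObj E]
  /-- the structure morphism -/
  s : standardRingScheme (Spec (.of A)) ⟶ E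
  [isRingHom : IsRingHom s]
  /-- the rank -/
  ℓ : ℕ
  /-- the chosen trivialisation -/
  ψ : E ≅ ∏ᶜ fun _ : Fin ℓ ↦ standardRingScheme (Spec (.of A))
  ψ_add {U : Over (Spec (.of A))} (x y : U ⟶ E) (i : Fin ℓ) :
    (x + y) ≫ ψ.hom ≫ Pi.π _ i = x ≫ ψ.hom ≫ Pi.π _ i + y ≫ ψ.hom ≫ Pi.π _ i
  ψ_smul {U : Over (Spec (.of A))} (a : U ⟶ standardRingScheme (Spec (.of A))) (x : U ⟶ E)
    (i : Fin ℓ) : ((a ≫ s) * x) ≫ ψ.hom ≫ Pi.π _ i = a * (x ≫ ψ.hom ≫ Pi.π _ i)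

attribute [instance] FiniteFreeAlgebraScheme.ring FiniteFreeAlgebraScheme.isRingHom

/-- `Spec R` as a scheme over `Spec A`, for an `A`-algebra `R`. -/
abbrev specOver (A R : Type u) [CommRing A] [CommRing R] [Algebra A R] : Over (Spec (.of A)) :=
  Over.mk (Spec.map (CommRingCat.ofHom (algebraMap A R)))

/-- A morphism of ring schemes `f : E ⟶ E'` induces ring homomorphisms `E(U) → E'(U)`. -/
def ringSchemeHomPoints {B : Scheme.{u}} {E E' : Over B} [CommRingObj E] [CommRingObj E']
    (f : E ⟶ E') [IsRingHom f] (U : Over B) : (U ⟶ E) →+* (U ⟶ E') where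
  toFun x := x ≫ f
  map_one' := by simp
  map_zero' := by simp
  map_mul' _ _ := MonObj.mul_comp _ _ _
  map_add' _ _ := AddMonObj.add_comp _ _ _

namespace FiniteFreeAlgebraScheme

variable {A : Type u} [CommRing A] (𝓔 : FiniteFreeAlgebraScheme A)
  (R : Type u) [CommRing R] [Algebra A R]

/-- The ring `𝓔(R)` of `R`-points of `𝓔` over `A`. -/
def Points : Type u := specOver A R ⟶ 𝓔.E

instance : CommRing (𝓔.Points R) := inferInstanceAs (CommRing (specOver A R ⟶ 𝓔.E))

/-- The standard map `s_𝓔^R : R = 𝕊(R) → 𝓔(R)`. -/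
def standardMap : R →+* 𝓔.Points R :=
  (ringSchemeHomPoints 𝓔.s (specOver A R)).comp
    ((standardPoints (specOver A R)).symm.toRingHom.comp (Scheme.ΓSpecIso (.of R)).inv.hom)

/-- The `A`-algebra structure `A → R → 𝓔(R)` on `𝓔(R)`. -/
instance : Algebra A (𝓔.Points R) := ((𝓔.standardMap R).comp (algebraMap A R)).toAlgebra

end FiniteFreeAlgebraScheme

end RingSchemes

section WeilRestriction

variable {S T : Scheme.{u}} (h : T ⟶ S)

/-- A Weil restriction of the `T`-scheme `Y` along `h : T ⟶ S`: a scheme `R_{T/S} Y` over `S` and a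
`T`-morphism `r : R_{T/S} Y ×_S T ⟶ Y` such that for every scheme `U` over `S` the map
`p ↦ r ∘ (p ×_S id_T)` is a bijection from `Hom_S(U, R_{T/S} Y)` to `Hom_T(U ×_S T, Y)`. -/
structure WeilRestriction (Y : Over T) where
  /-- the scheme `R_{T/S} Y` over `S` -/
  obj : Over S
  /-- the universal morphism -/
  r : (Over.pullback h).obj obj ⟶ Y
  bijective (U : Over S) :
    Function.Bijective fun p : U ⟶ obj ↦ (Over.pullback h).map p ≫ r

variable {h}

/-- The identification `Hom_S(U, R_{T/S} Y) ≃ Hom_T(U ×_S T, Y)`. -/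
def WeilRestriction.homEquiv {Y : Over T} (W : WeilRestriction h Y) (U : Over S) :
    (U ⟶ W.obj) ≃ ((Over.pullback h).obj U ⟶ Y) :=
  Equiv.ofBijective _ (W.bijective U)

/-- The morphism `R_{T/S}(g) : R_{T/S} Y ⟶ R_{T/S} Z` induced by a `T`-morphism `g : Y ⟶ Z`. -/
def WeilRestriction.map {Y Z : Over T} (W : WeilRestriction h Y) (W' : WeilRestriction h Z)
    (g : Y ⟶ Z) : W.obj ⟶ W'.obj :=
  (W'.homEquiv W.obj).symm (W.r ≫ g)

end WeilRestriction

section Prolongations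

variable {A : Type u} [CommRing A] (𝓔 : FiniteFreeAlgebraScheme A)
  {k : Type u} [CommRing k] [Algebra A k] (e : k →ₐ[A] 𝓔.Points k)

/-- The morphism `Spec 𝓔(k) ⟶ Spec k` given by the standard map `s_𝓔^k : k → 𝓔(k)`. -/
def standardSpec : Spec (.of (𝓔.Points k)) ⟶ Spec (.of k) :=
  Spec.map (CommRingCat.ofHom (𝓔.standardMap k))

/-- The morphism `Spec 𝓔(k) ⟶ Spec k` given by the exponential map `e : k → 𝓔(k)`. -/
def exponentialSpec : Spec (.of (𝓔.Points k)) ⟶ Spec (.of k) :=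
  Spec.map (CommRingCat.ofHom e.toRingHom)

/-- A prolongation space `τ(X, 𝓔, e)` of a scheme `X` over the `𝓔`-ring `(k, e)`: the Weil
restriction, along the standard map, of the base extension `X ×_k 𝓔^e(k)` of `X` along the
exponential map. -/
abbrev Prolongation (X : Over (Spec (.of k))) :=
  WeilRestriction (standardSpec 𝓔 (k := k)) ((Over.pullback (exponentialSpec 𝓔 e)).obj X)

variable {𝓔 e}

/-- `τ(f) = R_{𝓔(k)/k}(f ×_k 𝓔^e(k)) : τ(X) ⟶ τ(Y)`. -/
def Prolongation.map {X Y : Over (Spec (.of k))} (τX : Prolongation 𝓔 e X)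
    (τY : Prolongation 𝓔 e Y) (f : X ⟶ Y) : τX.obj ⟶ τY.obj :=
  WeilRestriction.map τX τY ((Over.pullback (exponentialSpec 𝓔 e)).map f)

end Prolongations

end ERing

end

/-!
The prolongation space is a Weil restriction along `Spec E ⟶ Spec k` with `E = 𝓔(k)`, and the
trivialisation `ψ` makes `E` a free `k`-module of rank `ℓ` (`FiniteFreeAlgebraScheme.pointsEquiv`).
Base change along the exponential map preserves étale morphisms, closed immersions and smooth
morphisms, so the statement is about the morphism `R(g) : R(Y) ⟶ R(Z)` of Weil restrictions induced
by a morphism `g : Y ⟶ Z` over `E`, for a finite free algebra `E` over `k`. As `Y` is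
arbitrary, `R(Y)` need not be covered by the Weil restrictions of the affine open subschemes of `Y`;
everything goes through the functors of points, using that a `U`-point of `R(Y)` is a
`U ×_k E`-point of `Y`.

*Locally of finite presentation.* This is equivalent to commutation with filtered colimits of rings.
One direction is in Mathlib, and passes from `g` to `R(g)` because base change along
`Spec E ⟶ Spec k` preserves limits (`WeilRestriction.exists_π_app_comp_eq`). For the converse
(`locallyOfFinitePresentation_of_exists_π_app_comp_eq`) an algebra is written as the union of its
finitely generated subalgebras, and then as a colimit of finitely presented algebras mapping onto
it.

*Smooth.* Infinitesimal lifting for `R(g)` against `Spec C ⟶ Spec B` is infinitesimal lifting for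
`g` against `Spec (C ⊗ E) ⟶ Spec (B ⊗ E)`. For a smooth morphism of schemes such lifts exist only
locally in general, and gluing them meets a cohomological obstruction. By the Jacobian criterion
over a residue field, it suffices to consider local rings `B` and surjections `B → C` whose kernel
is killed by the maximal ideal (`smooth_of_hasLiftingProperty`). As `E` is finite, the kernel of
`B ⊗ E → C ⊗ E` is then supported on a finite set of closed points; outside of it the thickening is
an isomorphism, so local lifts near these points agree on overlaps and glue
(`hasLiftingProperty_of_smooth_of_isIso`).

*Étale.* Étale is smooth and formally unramified, and uniqueness of infinitesimal lifts passes from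
`g` to `R(g)` directly (`WeilRestriction.formallyUnramified_map_left`).

*Closed immersion.* The locus in `Spec (B ⊗ E)` where a morphism to `Z` factors through `Y` is
`V(I)` for an ideal `I`. If `J ⊆ B` is generated by the coordinates of the elements of `I` in a
basis of `E`, then `V(J) ⊆ Spec B` is the locus where the corresponding morphism to `R(Z)` factors
through `R(Y)` (`exists_ideal_le_ker_tensorProduct_map_iff`,
`isClosedImmersion_of_forall_exists_ideal`).

The last assertion is the smooth case for `X ⟶ Spec k`, as the Weil restriction of a terminal
object is terminal (`WeilRestriction.ofIsTerminal`).
-/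

namespace ERing

/-! ### The functor of points of a Weil restriction -/

section WeilRestrictionFunctor

variable {S T : Scheme.{u}} {h : T ⟶ S}

namespace WeilRestriction

lemma homEquiv_comp {Y : Over T} (W : WeilRestriction h Y) {U V : Over S} (q : U ⟶ V)
    (p : V ⟶ W.obj) :
    W.homEquiv U (q ≫ p) = (Over.pullback h).map q ≫ W.homEquiv V p := by
  simp [homEquiv]

lemma homEquiv_comp_map {Y Z : Over T} (W : WeilRestriction h Y) (W' : WeilRestriction h Z)
    (g : Y ⟶ Z) {U : Over S} (p : U ⟶ W.obj) :
    W'.homEquiv U (p ≫ W.map W' g) = W.homEquiv U p ≫ g := by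
  rw [homEquiv_comp, map, Equiv.apply_symm_apply, homEquiv, Equiv.ofBijective_apply,
    Category.assoc]

/-- Lifting problems for `R_{T/S}(g)` are lifting problems for `g` after base change to `T`. -/
lemma hasLiftingProperty_map_left {Y Z : Over T} (W : WeilRestriction h Y)
    (W' : WeilRestriction h Z) (g : Y ⟶ Z) {T₀ T₁ : Scheme.{u}} (i : T₀ ⟶ T₁)
    (H : ∀ (s₀ : T₀ ⟶ S) (s₁ : T₁ ⟶ S) (w : i ≫ s₁ = s₀), HasLiftingProperty
      ((Over.pullback h).map (Over.homMk i w : Over.mk s₀ ⟶ Over.mk s₁)).left g.left) :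
    HasLiftingProperty i (W.map W' g).left where
  sq_hasLift {a b} sq := by
    let s : T₁ ⟶ S := b ≫ W'.obj.hom
    let ι : Over.mk (i ≫ s) ⟶ Over.mk s := Over.homMk i
    let a' : Over.mk (i ≫ s) ⟶ W.obj := Over.homMk a (by
      simp [s, ← reassoc_of% sq.w])
    let b' : Over.mk s ⟶ W'.obj := Over.homMk b
    have hab : a' ≫ W.map W' g = ι ≫ b' := by ext1; exact sq.w
    have hab' := congr(W'.homEquiv _ $hab)
    rw [homEquiv_comp_map, homEquiv_comp] at hab'
    have := H _ s rfl
    have sq' : CommSq (W.homEquiv _ a').left ((Over.pullback h).map ι).left g.left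
        (W'.homEquiv _ b').left := ⟨congr($(hab').left)⟩
    let c : (Over.pullback h).obj (Over.mk s) ⟶ Y := Over.homMk sq'.lift (by
      rw [← Over.w g, sq'.fac_right_assoc, Over.w])
    have hc₁ : (Over.pullback h).map ι ≫ c = W.homEquiv _ a' := by
      ext1; exact sq'.fac_left
    have hc₂ : c ≫ g = W'.homEquiv _ b' := by
      ext1; exact sq'.fac_right
    let d := (W.homEquiv _).symm c
    have hd₁ : ι ≫ d = a' := (W.homEquiv _).injective (by rw [homEquiv_comp]; simpa [d])
    have hd₂ : d ≫ W.map W' g = b' :=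
      (W'.homEquiv _).injective (by rw [homEquiv_comp_map]; simpa [d])
    exact ⟨⟨⟨d.left, congr($(hd₁).left), congr($(hd₂).left)⟩⟩⟩

end WeilRestriction

/-- Over an affine base, the base change functor `- ×_S T` takes `Spec R' ⟶ Spec R` to
`Spec (R' ⊗ E) ⟶ Spec (R ⊗ E)`. -/
noncomputable def pullbackMapSpecIso (k E : Type u) {R R' : Type u} [CommRing k] [CommRing E]
    [Algebra k E] [CommRing R] [Algebra k R] [CommRing R'] [Algebra k R'] (φ : R →ₐ[k] R') :
    Arrow.mk ((Over.pullback (Spec.map (CommRingCat.ofHom (algebraMap k E)))).map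
      (Over.homMk (Spec.map (CommRingCat.ofHom φ.toRingHom)) (by
          rw [← φ.comp_algebraMap, CommRingCat.ofHom_comp, Spec.map_comp]; rfl) :
        Over.mk (Spec.map (CommRingCat.ofHom (algebraMap k R'))) ⟶
          Over.mk (Spec.map (CommRingCat.ofHom (algebraMap k R))))).left ≅
      Arrow.mk (Spec.map (CommRingCat.ofHom
        (Algebra.TensorProduct.map φ (AlgHom.id k E)).toRingHom)) :=
  Arrow.isoMk (pullbackSpecIso k R' E) (pullbackSpecIso k R E) (by
    rw [← cancel_mono (pullbackSpecIso k R E).inv, ← cancel_epi (pullbackSpecIso k R' E).inv]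
    apply pullback.hom_ext
    · trans Spec.map (CommRingCat.ofHom Algebra.TensorProduct.includeLeftRingHom) ≫
        Spec.map (CommRingCat.ofHom φ.toRingHom)
      · simp [← Spec.map_comp, ← CommRingCat.ofHom_comp]
      · simp only [Arrow.mk_hom, Category.assoc, Iso.hom_inv_id, Category.comp_id,
          Over.pullback_map_left]
        erw [pullback.lift_fst]
        exact (pullbackSpecIso_inv_fst_assoc k R' E _).symm
    · trans Spec.map (CommRingCat.ofHom
        (Algebra.TensorProduct.includeRight : E →ₐ[k] TensorProduct k R' E).toRingHom)
      · simp only [Arrow.mk_left, pullbackSpecIso_inv_snd, ← Spec.map_comp,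
          ← CommRingCat.ofHom_comp, Category.assoc, Arrow.mk_hom, Iso.inv_hom_id_assoc]
        refine congrArg Spec.map (CommRingCat.hom_ext (RingHom.ext fun x ↦ ?_))
        simp
      · simp only [Arrow.mk_hom, Category.assoc, Iso.hom_inv_id, Category.comp_id,
          Over.pullback_map_left]
        erw [pullback.lift_snd]
        exact (pullbackSpecIso_inv_snd k R' E).symm)

/-- Against `Spec R' ⟶ Spec R`, lifting problems for `R_{E/k}(g)` are lifting problems for `g`
against `Spec (R' ⊗ E) ⟶ Spec (R ⊗ E)`. -/
lemma WeilRestriction.hasLiftingProperty_specMap_map_left {k E : Type u} [CommRing k] [CommRing E]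
    [Algebra k E] {Y Z : Over (Spec (.of E))}
    (W : WeilRestriction (Spec.map (CommRingCat.ofHom (algebraMap k E))) Y)
    (W' : WeilRestriction (Spec.map (CommRingCat.ofHom (algebraMap k E))) Z) (g : Y ⟶ Z)
    {R R' : Type u} [CommRing R] [CommRing R'] (φ : R →+* R')
    (H : ∀ (_ : Algebra k R) (_ : Algebra k R') (ψ : R →ₐ[k] R'), ψ.toRingHom = φ →
      HasLiftingProperty (Spec.map (CommRingCat.ofHom
        (Algebra.TensorProduct.map ψ (AlgHom.id k E)).toRingHom)) g.left) :
    HasLiftingProperty (Spec.map (CommRingCat.ofHom φ)) (W.map W' g).left := by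
  refine hasLiftingProperty_map_left W W' g _ fun s₀ s₁ w ↦ ?_
  obtain ⟨σ, rfl⟩ := Spec.map_surjective s₁
  let : Algebra k R := σ.hom.toAlgebra
  let : Algebra k R' := (φ.comp σ.hom).toAlgebra
  let ψ : R →ₐ[k] R' := { φ with commutes' := fun _ ↦ rfl }
  have hs₀ : s₀ = Spec.map (CommRingCat.ofHom (algebraMap k R')) := by
    rw [← w, ← Spec.map_comp]; rfl
  subst hs₀
  have := H _ _ ψ rfl
  exact HasLiftingProperty.of_arrow_iso_left (pullbackMapSpecIso k E ψ).symm g.left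

end WeilRestrictionFunctor

/-! ### Infinitesimal lifting for smooth morphisms of schemes -/

section InfinitesimalLifting

/-- Lifts of smooth morphisms along a nilpotent thickening exist locally. -/
lemma exists_local_lift_of_smooth {Z' Z X Y : Scheme.{u}} (i : Z' ⟶ Z) [IsClosedImmersion i]
    (hi : IsNilpotent i.ker) (f : X ⟶ Y) [Smooth f] (a : Z' ⟶ X) (b : Z ⟶ Y) (w : a ≫ f = i ≫ b)
    (z : Z) (O : Z.Opens) (hz : z ∈ O) :
    ∃ (W : Z.Opens) (c : W.toScheme ⟶ X), z ∈ W ∧ W ≤ O ∧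
      i ∣_ W ≫ c = (i ⁻¹ᵁ W).ι ≫ a ∧ c ≫ f = W.ι ≫ b := by
  have : IsDominant i := by
    obtain ⟨n, hn⟩ := hi
    rw [isDominant_iff, denseRange_iff_closure_range, ← i.support_ker,
      ← i.ker.support_pow (n + 1) (by simp), pow_succ, hn]
    simp
  obtain ⟨z', rfl⟩ := i.surjective z
  obtain ⟨_, ⟨U, hU, rfl⟩, hzU, -⟩ :=
    Y.isBasis_affineOpens.exists_subset_of_mem_open (Set.mem_univ (f (a z'))) isOpen_univ
  obtain ⟨_, ⟨V, hV, rfl⟩, hzV, hVU : V ≤ f ⁻¹ᵁ U⟩ :=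
    X.isBasis_affineOpens.exists_subset_of_mem_open hzU (f ⁻¹ᵁ U).isOpen
  -- As `i` is a homeomorphism, the open set `a ⁻¹ V` of `Z'` comes from an open set of `Z`.
  let O' : Z.Opens := ⟨(i '' (a ⁻¹ᵁ V : Set Z')ᶜ)ᶜ,
    (i.isClosedEmbedding.isClosedMap _ (a ⁻¹ᵁ V).isOpen.isClosed_compl).isOpen_compl⟩
  have hO' : i ⁻¹ᵁ O' ≤ a ⁻¹ᵁ V := fun x hx ↦ by
    by_contra hx'
    exact hx ⟨x, hx', rfl⟩
  have hzO' : i z' ∈ O' := by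
    rintro ⟨x, hx, hxz⟩
    exact hx (i.isClosedEmbedding.injective hxz ▸ hzV)
  have hzbU : i z' ∈ b ⁻¹ᵁ U := by
    have : b (i z') = f (a z') := congr($w.symm z')
    change b (i z') ∈ U
    rwa [this]
  obtain ⟨_, ⟨W, hW, rfl⟩, hzW, hWO : W ≤ O ⊓ O' ⊓ b ⁻¹ᵁ U⟩ :=
    Z.isBasis_affineOpens.exists_subset_of_mem_open
      (show i z' ∈ O ⊓ O' ⊓ b ⁻¹ᵁ U from ⟨⟨hz, hzO'⟩, hzbU⟩) (O ⊓ O' ⊓ b ⁻¹ᵁ U).isOpen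
  have hWV : i ⁻¹ᵁ W ≤ a ⁻¹ᵁ V := fun x hx ↦ hO' (hWO hx).1.2
  have hWU : W ≤ b ⁻¹ᵁ U := fun x hx ↦ (hWO hx).2
  have := f.smooth_appLE hU hV hVU
  algebraize [(f.appLE U V hVU).hom, (b.appLE U W hWU).hom,
    ((i ≫ b).appLE U (i ⁻¹ᵁ W) (fun x hx ↦ hWU hx)).hom]
  have h₁ : b.appLE U W hWU ≫ i.app W = (i ≫ b).appLE U (i ⁻¹ᵁ W) (fun x hx ↦ hWU hx) := by
    rw [Scheme.Hom.app_eq_appLE, Scheme.Hom.appLE_comp_appLE]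
  have h₂ : f.appLE U V hVU ≫ a.appLE V _ hWV =
      (i ≫ b).appLE U (i ⁻¹ᵁ W) (fun x hx ↦ hWU hx) := by
    simp_rw [Scheme.Hom.appLE_comp_appLE, w]
  let φ : Γ(Z, W) →ₐ[Γ(Y, U)] Γ(Z', i ⁻¹ᵁ W) := ⟨(i.app W).hom, fun r ↦ congr($(h₁).hom r)⟩
  let α : Γ(X, V) →ₐ[Γ(Y, U)] Γ(Z', i ⁻¹ᵁ W) := ⟨(a.appLE V _ hWV).hom, fun r ↦ congr($(h₂).hom r)⟩
  have hφ : Function.Surjective φ := i.app_surjective W hW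
  have hφ' : IsNilpotent (RingHom.ker (φ : Γ(Z, W) →+* Γ(Z', i ⁻¹ᵁ W))) := by
    obtain ⟨n, hn⟩ := hi
    have hφi : RingHom.ker (φ : Γ(Z, W) →+* Γ(Z', i ⁻¹ᵁ W)) = RingHom.ker (i.app W).hom := rfl
    exact ⟨n, by simpa [hφi] using congr(($hn).ideal ⟨W, hW⟩)⟩
  let ψ := Algebra.FormallySmooth.liftOfSurjective α φ hφ hφ'
  have hψ : φ.comp ψ = α := Algebra.FormallySmooth.comp_liftOfSurjective α φ hφ hφ'
  have hψ₁ : CommRingCat.ofHom ψ.toRingHom ≫ i.app W = a.appLE V _ hWV :=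
    CommRingCat.hom_ext (congrArg AlgHom.toRingHom hψ)
  have hψ₂ : f.appLE U V hVU ≫ CommRingCat.ofHom ψ.toRingHom = b.appLE U W hWU :=
    CommRingCat.hom_ext ψ.comp_algebraMap
  refine ⟨W, Scheme.Opens.toSpecΓ W ≫ Spec.map (CommRingCat.ofHom ψ.toRingHom) ≫ hV.fromSpec, hzW,
    fun x hx ↦ (hWO hx).1.1, ?_, ?_⟩
  · rw [← Scheme.Opens.toSpecΓ_naturality_assoc, ← Spec.map_comp_assoc, hψ₁,
      Scheme.Opens.toSpecΓ_SpecMap_appLE_assoc, hV.toSpecΓ_fromSpec, Scheme.Hom.resLE_comp_ι]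
  · rw [Category.assoc, Category.assoc, ← hU.SpecMap_appLE_fromSpec f hV hVU,
      ← Spec.map_comp_assoc, hψ₂, Scheme.Opens.toSpecΓ_SpecMap_appLE_assoc, hU.toSpecΓ_fromSpec,
      Scheme.Hom.resLE_comp_ι]

lemma isIso_morphismRestrict_of_le {X Y : Scheme.{u}} (f : X ⟶ Y) {U V : Y.Opens} (hVU : V ≤ U)
    [IsIso (f ∣_ U)] : IsIso (f ∣_ V) := by
  have hV : U.ι ''ᵁ (U.ι ⁻¹ᵁ V) = V := by
    rw [Scheme.Hom.image_preimage_eq_opensRange_inf, Scheme.Opens.opensRange_ι,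
      inf_eq_right.mpr hVU]
  rw [← hV]
  exact ((MorphismProperty.isomorphisms _).arrow_mk_iso_iff
    (morphismRestrictRestrict f U (U.ι ⁻¹ᵁ V))).mp (inferInstanceAs (IsIso (f ∣_ U ∣_ _)))

/-- Suppose the nilpotent thickening `i` is an isomorphism over the open set `O`, and every point
of `Z` has a neighbourhood containing no further point outside `O`. Then local lifts along `i` can
be chosen so that any two domains overlap inside `O`, where lifts are unique, so they glue. -/
lemma hasLiftingProperty_of_smooth_of_isIso {Z' Z X Y : Scheme.{u}} (i : Z' ⟶ Z)
    [IsClosedImmersion i] (hi : IsNilpotent i.ker) (f : X ⟶ Y) [Smooth f] (O : Z.Opens)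
    [IsIso (i ∣_ O)]
    (hO : ∀ z : Z, ∃ N : Z.Opens, z ∈ N ∧ ∀ y ∈ N, y ∉ O → y = z) :
    HasLiftingProperty i f where
  sq_hasLift {a b} sq := by
    choose N hzN hN using hO
    choose W c hzW hWN hc₁ hc₂ using fun z ↦
      exists_local_lift_of_smooth i hi f a b sq.w z (N z) (hzN z)
    have hW : TopologicalSpace.IsOpenCover W :=
      TopologicalSpace.IsOpenCover.mk (by ext x; simpa using ⟨x, hzW x⟩)
    have hWW {x y : Z} (hxy : x ≠ y) : W x ⊓ W y ≤ O := fun z hz ↦ by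
      by_contra hzO
      exact hxy ((hN x z (hWN x hz.1) hzO).symm.trans (hN y z (hWN y hz.2) hzO))
    have hglue (x y : Z) :
        pullback.fst (W x).ι (W y).ι ≫ c x = pullback.snd (W x).ι (W y).ι ≫ c y := by
      rw [← cancel_epi (isPullback_opens_inf (W x) (W y)).isoPullback.hom]
      simp only [IsPullback.isoPullback_hom_fst_assoc, IsPullback.isoPullback_hom_snd_assoc]
      obtain rfl | hxy := eq_or_ne x y
      · rfl
      have := isIso_morphismRestrict_of_le i (hWW hxy)
      rw [← cancel_epi (i ∣_ (W x ⊓ W y))]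
      have key (z : Z) (hz : W x ⊓ W y ≤ W z) :
          i ∣_ (W x ⊓ W y) ≫ Z.homOfLE hz ≫ c z = (i ⁻¹ᵁ (W x ⊓ W y)).ι ≫ a := by
        rw [← Scheme.homOfLE_ι_assoc _ (i.preimage_mono hz), ← hc₁]
        simp [← Scheme.Hom.resLE_eq_morphismRestrict]
      rw [key, key]
    let 𝒰 : Z.OpenCover := Z.openCoverOfIsOpenCover W hW
    let d : Z ⟶ X := 𝒰.glueMorphisms c hglue
    have hd (x : Z) : (W x).ι ≫ d = c x := 𝒰.ι_glueMorphisms c _ x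
    refine ⟨⟨⟨d, ?_, ?_⟩⟩⟩
    · refine Scheme.hom_ext_of_forall _ _ fun z ↦ ⟨i ⁻¹ᵁ W (i z), hzW _, ?_⟩
      rw [← hc₁, ← morphismRestrict_ι_assoc, hd]
    · refine Scheme.hom_ext_of_forall _ _ fun z ↦ ⟨W z, hzW _, ?_⟩
      rw [← hc₂, ← hd, Category.assoc]

lemma isNilpotent_ker_specMap {B C : Type u} [CommRing B] [CommRing C] (φ : B →+* C)
    (hφ : IsNilpotent (RingHom.ker φ)) : IsNilpotent (Spec.map (CommRingCat.ofHom φ)).ker := by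
  obtain ⟨n, hn⟩ := hφ
  refine ⟨n, ?_⟩
  have h : RingHom.ker (Spec.map (CommRingCat.ofHom φ)).appTop.hom =
      (RingHom.ker φ).map (Scheme.ΓSpecIso (.of B)).inv.hom := by
    change _ = Ideal.map (Scheme.ΓSpecIso (.of B)).commRingCatIsoToRingEquiv.symm _
    rw [Ideal.map_symm]
    ext x
    have := congr($(Scheme.ΓSpecIso_naturality (CommRingCat.ofHom φ)).hom x)
    simp only [CommRingCat.hom_comp, RingHom.comp_apply, CommRingCat.hom_ofHom] at this
    rw [Ideal.mem_comap, RingHom.mem_ker, RingHom.mem_ker]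
    erw [← this]
    exact ((map_eq_zero_iff _ (ConcreteCategory.bijective_of_isIso
      (Scheme.ΓSpecIso (.of C)).hom).1).symm)
  rw [Scheme.ker_of_isAffine, h]
  refine Scheme.IdealSheafData.ext (funext fun U ↦ ?_)
  simp only [Scheme.IdealSheafData.ideal_pow, Pi.pow_apply,
    Scheme.IdealSheafData.ofIdealTop_ideal, ← Ideal.map_pow, hn]
  simp

lemma isIso_specMap_restrict_basicOpen {B C : Type u} [CommRing B] [CommRing C] (φ : B →+* C)
    (hφ : Function.Surjective φ) {r : B} (hr : r ∈ (RingHom.ker φ).annihilator) :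
    IsIso (Spec.map (CommRingCat.ofHom φ) ∣_ (PrimeSpectrum.basicOpen r)) := by
  refine ((MorphismProperty.isomorphisms _).arrow_mk_iso_iff
    (SpecMapRestrictBasicOpenIso (CommRingCat.ofHom φ) r)).mpr ?_
  suffices Function.Bijective (Localization.awayMap φ r) by
    have : IsIso (CommRingCat.ofHom (Localization.awayMap φ r)) :=
      (ConcreteCategory.isIso_iff_bijective _).mpr this
    exact (inferInstance : IsIso (Spec.map (CommRingCat.ofHom (Localization.awayMap φ r))))
  constructor
  · rw [injective_iff_map_eq_zero]
    intro x hx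
    obtain ⟨b, ⟨_, n, rfl⟩, rfl⟩ := IsLocalization.exists_mk'_eq (Submonoid.powers r) x
    rw [Localization.awayMap, IsLocalization.Away.map, IsLocalization.map_mk',
      IsLocalization.mk'_eq_zero_iff] at hx
    obtain ⟨⟨_, m, rfl⟩, hm⟩ := hx
    rw [IsLocalization.mk'_eq_zero_iff]
    refine ⟨⟨r ^ (m + 1), m + 1, rfl⟩, ?_⟩
    have : r ^ m * b ∈ RingHom.ker φ := by simpa using hm
    simpa [pow_succ', mul_assoc] using Submodule.mem_annihilator.mp hr _ this
  · have : IsLocalization ((Submonoid.powers r).map φ) (Localization.Away (φ r)) := by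
      rw [Submonoid.map_powers]; infer_instance
    exact IsLocalization.map_surjective_of_surjective (Submonoid.powers r) _ _ hφ

/-- A smooth morphism has the lifting property against a nilpotent thickening of affine schemes
whose ideal is supported on a finite set of closed points. -/
lemma hasLiftingProperty_specMap_of_smooth {B C : Type u} [CommRing B] [CommRing C] (φ : B →+* C)
    (hφ : Function.Surjective φ) (hI : IsNilpotent (RingHom.ker φ))
    (hfin : (PrimeSpectrum.zeroLocus ((RingHom.ker φ).annihilator : Set B)).Finite)
    (hmax : ∀ p ∈ PrimeSpectrum.zeroLocus ((RingHom.ker φ).annihilator : Set B),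
      p.asIdeal.IsMaximal)
    {X Y : Scheme.{u}} (f : X ⟶ Y) [Smooth f] :
    HasLiftingProperty (Spec.map (CommRingCat.ofHom φ)) f := by
  have : IsClosedImmersion (Spec.map (CommRingCat.ofHom φ)) :=
    IsClosedImmersion.spec_of_surjective _ hφ
  let O : (Spec (.of B)).Opens := ⨆ r : (RingHom.ker φ).annihilator, PrimeSpectrum.basicOpen r.1
  have hO (p : Spec (.of B)) :
      p ∉ O ↔ p ∈ PrimeSpectrum.zeroLocus ((RingHom.ker φ).annihilator : Set B) := by
    have hp : p ∈ O ↔ ∃ r : (RingHom.ker φ).annihilator, r.1 ∉ p.asIdeal :=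
      TopologicalSpace.Opens.mem_iSup
    rw [hp, not_exists]
    exact ⟨fun h r hr ↦ not_not.mp (h ⟨r, hr⟩), fun h r hr ↦ hr (h r.2)⟩
  have : IsIso (Spec.map (CommRingCat.ofHom φ) ∣_ O) := by
    let U (r : (RingHom.ker φ).annihilator) : (Spec (.of B)).Opens := PrimeSpectrum.basicOpen r.1
    refine IsZariskiLocalAtTarget.of_iSup_eq_top (P := .isomorphisms _) (fun r ↦ O.ι ⁻¹ᵁ U r) ?_ ?_
    · rw [← Scheme.Hom.preimage_iSup]
      exact Scheme.Opens.ι_preimage_self O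
    · intro r
      have h : O.ι ''ᵁ (O.ι ⁻¹ᵁ U r) = U r := by
        rw [Scheme.Hom.image_preimage_eq_opensRange_inf, Scheme.Opens.opensRange_ι]
        exact inf_eq_right.mpr (le_iSup U r)
      refine ((MorphismProperty.isomorphisms _).arrow_mk_iso_iff
        (morphismRestrictRestrict _ O (O.ι ⁻¹ᵁ U r))).mpr ?_
      rw [h]
      exact isIso_specMap_restrict_basicOpen φ hφ r.2
  refine hasLiftingProperty_of_smooth_of_isIso _ (isNilpotent_ker_specMap φ hI) f O fun z ↦ ?_
  have hclosed :
      IsClosed ((PrimeSpectrum.zeroLocus ((RingHom.ker φ).annihilator : Set B)) \ {z}) := by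
    rw [← Set.biUnion_of_singleton (_ \ _)]
    refine (hfin.subset Set.sdiff_subset).isClosed_biUnion fun p hp ↦ ?_
    exact (PrimeSpectrum.isClosed_singleton_iff_isMaximal p).mpr (hmax p hp.1)
  refine ⟨⟨_, hclosed.isOpen_compl⟩, fun h ↦ h.2 rfl, fun y hy hyO ↦ ?_⟩
  by_contra hyz
  exact hy ⟨(hO y).mp hyO, hyz⟩

/-- Let `B` be local, `B'` a finite `B`-algebra and `B' → C'` a surjection whose kernel is killed by
the maximal ideal of `B`. The kernel is then supported on the closed fibre of `Spec B' ⟶ Spec B`,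
which is a finite set of closed points. -/
lemma hasLiftingProperty_of_smooth_of_finite {B B' C' : Type u} [CommRing B] [IsLocalRing B]
    [CommRing B'] [CommRing C'] [Algebra B B'] [Module.Finite B B'] (φ : B' →+* C')
    (hφ : Function.Surjective φ) (hI : IsNilpotent (RingHom.ker φ))
    (hmB : ∀ b ∈ IsLocalRing.maximalIdeal B, ∀ x ∈ RingHom.ker φ, b • x = 0)
    {X Y : Scheme.{u}} (f : X ⟶ Y) [Smooth f] :
    HasLiftingProperty (Spec.map (CommRingCat.ofHom φ)) f := by
  have hle : (IsLocalRing.maximalIdeal B).map (algebraMap B B') ≤ (RingHom.ker φ).annihilator := by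
    rw [Ideal.map_le_iff_le_comap]
    intro b hb
    rw [Ideal.mem_comap, Submodule.mem_annihilator]
    intro x hx
    simpa [Algebra.smul_def] using hmB b hb x hx
  have hcomap (p : PrimeSpectrum B')
      (hp : p ∈ PrimeSpectrum.zeroLocus ((RingHom.ker φ).annihilator : Set B')) :
      p.asIdeal.comap (algebraMap B B') = IsLocalRing.maximalIdeal B := by
    refine le_antisymm (IsLocalRing.le_maximalIdeal ?_)
      (Ideal.map_le_iff_le_comap.mp (hle.trans hp))
    exact (Ideal.IsPrime.comap _).ne_top
  refine hasLiftingProperty_specMap_of_smooth φ hφ hI ?_ ?_ f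
  · refine (Algebra.QuasiFinite.finite_comap_preimage_singleton (R := B) (S := B')
      (IsLocalRing.closedPoint B)).subset fun p hp ↦ ?_
    exact PrimeSpectrum.ext (hcomap p hp)
  · intro p hp
    have := hcomap p hp
    exact Ideal.isMaximal_of_isIntegral_of_isMaximal_comap p.asIdeal
      (this ▸ IsLocalRing.maximalIdeal.isMaximal B)

end InfinitesimalLifting

/-! ### A criterion for smoothness by small extensions of local rings -/

section LocalCriterion

open TensorProduct IsLocalRing

lemma one_tmul_eq_zero_iff_mem_ker_smul_top {P κ M : Type*} [CommRing P] [CommRing κ] [Algebra P κ]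
    [AddCommGroup M] [Module P M] (h : Function.Surjective (algebraMap P κ)) (x : M) :
    (1 : κ) ⊗ₜ[P] x = 0 ↔ x ∈ RingHom.ker (algebraMap P κ) • (⊤ : Submodule P M) := by
  let e : (P ⧸ RingHom.ker (algebraMap P κ)) ≃ₐ[P] κ :=
    Ideal.quotientKerAlgEquivOfSurjective (f := Algebra.ofId P κ) h
  let e' := (TensorProduct.congr e.symm.toLinearEquiv (LinearEquiv.refl P M)).trans
    (TensorProduct.quotTensorEquivQuotSMul M (RingHom.ker (algebraMap P κ)))
  have : e' (1 ⊗ₜ x) = Submodule.Quotient.mk x := by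
    have h1 : e.symm 1 = Ideal.Quotient.mk _ 1 := by simp
    simp only [e', LinearEquiv.trans_apply, TensorProduct.congr_tmul, LinearEquiv.refl_apply,
      AlgEquiv.toLinearEquiv_apply, h1, TensorProduct.quotTensorEquivQuotSMul_mk_tmul, one_smul]
  rw [← e'.map_eq_zero_iff, this, Submodule.Quotient.mk_eq_zero]

/-- Formal smoothness of a local algebra `S` presented as `P / J` with `P` local can be tested on
the small extension `P / 𝔪 J ⟶ S`: a section of it yields a derivation whose linearization
retracts `κ ⊗ J / J²` from `κ ⊗ Ω[P⁄R]`, which is what the Jacobian criterion asks for. -/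
lemma formallySmooth_of_exists_section {R S P : Type u} [CommRing R] [CommRing S] [IsLocalRing S]
    [Algebra R S] [CommRing P] [IsLocalRing P] [Algebra R P] [Algebra P S] [IsScalarTower R P S]
    [Algebra.FormallySmooth R P] [Module.Free P Ω[P⁄R]] [Module.Finite P Ω[P⁄R]]
    (h₁ : Function.Surjective (algebraMap P S)) (h₂ : (RingHom.ker (algebraMap P S)).FG)
    (H : ∀ (B : Type u) [CommRing B] [IsLocalRing B] [Algebra R B] (φ : B →ₐ[R] S),
      Function.Surjective φ → (∀ b ∈ maximalIdeal B, ∀ x ∈ RingHom.ker φ, b * x = 0) →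
      ∃ σ : S →ₐ[R] B, φ.comp σ = AlgHom.id R S) :
    Algebra.FormallySmooth R S := by
  rw [Algebra.FormallySmooth.iff_injective_cotangentComplexBaseChange_residueField P h₁ h₂]
  set J := RingHom.ker (algebraMap P S) with hJ
  have hJm : J ≤ maximalIdeal P := IsLocalRing.le_maximalIdeal (RingHom.ker_ne_top _)
  have hQ : maximalIdeal P * J ≤ J := Ideal.mul_le_right
  let B := P ⧸ (maximalIdeal P * J)
  have : Nontrivial B := Ideal.Quotient.nontrivial_iff.mpr fun h ↦
    (maximalIdeal.isMaximal P).ne_top (top_le_iff.mp (h ▸ Ideal.mul_le_left))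
  have : IsLocalRing B := .of_surjective' _ Ideal.Quotient.mk_surjective
  let φ : B →ₐ[R] S := Ideal.Quotient.liftₐ _ (IsScalarTower.toAlgHom R P S) fun x hx ↦ hQ hx
  have hφmk (p : P) : φ (Ideal.Quotient.mk _ p) = algebraMap P S p := rfl
  have hφ : Function.Surjective φ := fun s ↦ (h₁ s).imp' (Ideal.Quotient.mk _) fun p hp ↦ hp
  have hker {x : B} (hx : φ x = 0) : ∃ j ∈ J, Ideal.Quotient.mk _ j = x := by
    obtain ⟨j, rfl⟩ := Ideal.Quotient.mk_surjective x
    exact ⟨j, hx, rfl⟩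
  have hsmall {m : P} (hm : m ∈ maximalIdeal P) {x : B} (hx : φ x = 0) :
      Ideal.Quotient.mk _ m * x = 0 := by
    obtain ⟨j, hj, rfl⟩ := hker hx
    rw [← map_mul, Ideal.Quotient.eq_zero_iff_mem]
    exact Ideal.mul_mem_mul hm hj
  obtain ⟨σ, hσ⟩ := H B φ hφ fun b hb x hx ↦ by
    obtain ⟨m, rfl⟩ := Ideal.Quotient.mk_surjective b
    exact hsmall ((mem_maximalIdeal m).mpr fun hm ↦ hb (hm.map _)) hx
  have hσ' (s : S) : φ (σ s) = s := congr($hσ s)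
  let d₀ : P →ₗ[R] B := (Ideal.Quotient.mkₐ R (maximalIdeal P * J)).toLinearMap -
    (σ.comp (IsScalarTower.toAlgHom R P S)).toLinearMap
  have hd₀ (p : P) : d₀ p = Ideal.Quotient.mk _ p - σ (algebraMap P S p) := rfl
  have hφd (p : P) : φ (d₀ p) = 0 := by rw [hd₀, map_sub, hσ', hφmk, sub_self]
  let d : Derivation R P B := Derivation.mk' d₀ fun p q ↦ by
    obtain ⟨j, hj, hjp⟩ := hker (hφd p)
    have h0 : d₀ p * d₀ q = 0 := by rw [← hjp]; exact hsmall (hJm hj) (hφd q)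
    rw [hd₀, hd₀] at h0
    simp only [hd₀, Algebra.smul_def, map_mul]
    change _ = Ideal.Quotient.mk _ p * _ + Ideal.Quotient.mk _ q * _
    linear_combination -h0
  have hL {m : P} (hm : m ∈ maximalIdeal P) (ω : Ω[P⁄R]) : m • d.liftKaehlerDifferential ω = 0 := by
    have hω : ω ∈ Submodule.span P (Set.range (KaehlerDifferential.D R P)) := by
      rw [KaehlerDifferential.span_range_derivation]; trivial
    induction hω using Submodule.span_induction with
    | mem _ h =>
      obtain ⟨p, rfl⟩ := h
      rw [Derivation.liftKaehlerDifferential_comp_D]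
      exact (Algebra.smul_def _ _).trans (hsmall hm (hφd p))
    | zero => rw [map_zero, smul_zero]
    | add _ _ _ _ h h' => rw [map_add, smul_add, h, h', add_zero]
    | smul a _ _ h => rw [map_smul, smul_comm, h, smul_zero]
  rw [injective_iff_map_eq_zero]
  intro y hy
  have hP : Function.Surjective (algebraMap P (ResidueField S)) := by
    rw [IsScalarTower.algebraMap_eq P S]
    exact residue_surjective.comp h₁
  have hPker : RingHom.ker (algebraMap P (ResidueField S)) = maximalIdeal P :=
    eq_maximalIdeal (RingHom.ker_isMaximal_of_surjective _ hP)
  obtain ⟨x, rfl⟩ := TensorProduct.mk_surjective P J _ hP y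
  simp only [TensorProduct.mk_apply] at hy ⊢
  rw [KaehlerDifferential.cotangentComplexBaseChange_tmul, one_smul,
    KaehlerDifferential.kerToTensor_apply, one_tmul_eq_zero_iff_mem_ker_smul_top hP] at hy
  replace hy : KaehlerDifferential.D R P x ∈ maximalIdeal P • (⊤ : Submodule P Ω[P⁄R]) :=
    hPker ▸ hy
  have hLx : d.liftKaehlerDifferential (KaehlerDifferential.D R P x) = 0 := by
    refine Submodule.smul_induction_on hy (fun m hm ω _ ↦ ?_) fun a b ha hb ↦ ?_
    · rw [map_smul, hL hm]
    · rw [map_add, ha, hb, add_zero]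
  rw [Derivation.liftKaehlerDifferential_comp_D] at hLx
  have hx : (x : P) ∈ maximalIdeal P * J := by
    rw [← Ideal.Quotient.eq_zero_iff_mem]
    have : algebraMap P S x = 0 := x.2
    simpa [d, hd₀, this] using hLx
  rw [one_tmul_eq_zero_iff_mem_ker_smul_top hP, hPker]
  have hmap : (maximalIdeal P • (⊤ : Submodule P J)).map J.subtype = maximalIdeal P * J := by
    rw [Submodule.map_smul'', Submodule.map_top, Submodule.range_subtype, smul_eq_mul]
  rw [← hmap] at hx
  obtain ⟨x', hx', hxx'⟩ := hx
  rwa [← Subtype.ext hxx']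

/-- The same test for a localization of an algebra of finite presentation at a prime. -/
lemma formallySmooth_localization_of_exists_section {A C : Type u} [CommRing A] [CommRing C]
    [Algebra A C] [Algebra.FinitePresentation A C] (q : Ideal C) [q.IsPrime]
    (H : ∀ (B : Type u) [CommRing B] [IsLocalRing B] [Algebra A B]
      (φ : B →ₐ[A] Localization.AtPrime q),
      Function.Surjective φ → (∀ b ∈ maximalIdeal B, ∀ x ∈ RingHom.ker φ, b * x = 0) →
      ∃ σ : Localization.AtPrime q →ₐ[A] B, φ.comp σ = AlgHom.id A _) :
    Algebra.FormallySmooth A (Localization.AtPrime q) := by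
  obtain ⟨n, f₀, hf₀⟩ := Algebra.FiniteType.iff_quotient_mvPolynomial''.mp
    (inferInstance : Algebra.FiniteType A C)
  let S := Localization.AtPrime q
  let M := (q.comap f₀).primeCompl
  let P := Localization M
  let fP : P →ₐ[A] S := IsLocalization.liftAlgHom (M := M)
    (f := (IsScalarTower.toAlgHom A C S).comp f₀) fun x ↦
      IsLocalization.map_units S (⟨f₀ x.1, x.2⟩ : q.primeCompl)
  have hfP_alg (x : MvPolynomial (Fin n) A) :
      fP (algebraMap _ P x) = algebraMap C S (f₀ x) := IsLocalization.lift_eq _ x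
  have hfP_mk (x : MvPolynomial (Fin n) A) (s : M) :
      fP (IsLocalization.mk' P x s) =
        IsLocalization.mk' S (f₀ x) (⟨f₀ s.1, s.2⟩ : q.primeCompl) := by
    rw [eq_comm, IsLocalization.mk'_eq_iff_eq_mul, ← hfP_alg, ← hfP_alg, ← map_mul,
      IsLocalization.mk'_spec]
  have hf₁ : Function.Surjective fP := by
    intro x
    obtain ⟨x, ⟨s, hs⟩, rfl⟩ := IsLocalization.exists_mk'_eq q.primeCompl x
    obtain ⟨x, rfl⟩ := hf₀ x
    obtain ⟨s, rfl⟩ := hf₀ s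
    exact ⟨IsLocalization.mk' P x (⟨s, hs⟩ : M), hfP_mk _ _⟩
  have hfP : (RingHom.ker fP).FG := by
    have := Algebra.FinitePresentation.ker_fG_of_surjective _ hf₀
    convert! this.map (algebraMap _ P)
    refine le_antisymm ?_ (Ideal.map_le_iff_le_comap.mpr fun x hx ↦ ?_)
    swap
    · have hx' : f₀ x = 0 := hx
      rw [Ideal.mem_comap, RingHom.mem_ker, hfP_alg, hx', map_zero]
    intro x hx
    obtain ⟨x, s, rfl⟩ := IsLocalization.exists_mk'_eq M x
    rw [RingHom.mem_ker, hfP_mk, IsLocalization.mk'_eq_zero_iff] at hx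
    obtain ⟨⟨a, ha⟩, e⟩ := hx
    obtain ⟨a, rfl⟩ := hf₀ a
    rw [IsLocalization.mk'_mem_map_algebraMap_iff]
    exact ⟨a, ha, by simpa using e⟩
  algebraize [fP.toRingHom]
  have : IsScalarTower A P S := .of_algebraMap_eq' fP.comp_algebraMap.symm
  have : Algebra.FormallyEtale (MvPolynomial (Fin n) A) P := .of_isLocalization M
  have : Algebra.FormallySmooth A P := .comp _ (MvPolynomial (Fin n) A) _
  have : Module.Free P Ω[P⁄A] := .of_equiv
    (KaehlerDifferential.tensorKaehlerEquivOfFormallyEtale A (MvPolynomial (Fin n) A) P)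
  have : IsLocalRing P := Localization.AtPrime.isLocalRing (q.comap f₀)
  exact formallySmooth_of_exists_section hf₁ hfP H

/-- A lift to a local ring `B` of the localization map `C → C_q` extends to a section of the local
homomorphism `B → C_q`. -/
lemma exists_section_of_lift {A B C : Type u} [CommRing A] [CommRing B] [IsLocalRing B]
    [CommRing C] [Algebra A B] [Algebra A C] (q : Ideal C) [q.IsPrime]
    (φ : B →ₐ[A] Localization.AtPrime q) (hφ : Function.Surjective φ) (γ : C →ₐ[A] B)
    (hγ : ∀ x, φ (γ x) = algebraMap C (Localization.AtPrime q) x) :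
    ∃ σ : Localization.AtPrime q →ₐ[A] B, φ.comp σ = AlgHom.id A _ := by
  have hloc : IsLocalHom φ.toRingHom := .of_surjective _ hφ
  have hunit (y : q.primeCompl) : IsUnit (γ y) := by
    refine hloc.map_nonunit _ ?_
    change IsUnit (φ (γ y))
    rw [hγ]
    exact IsLocalization.map_units _ y
  let σ : Localization.AtPrime q →ₐ[A] B := IsLocalization.liftAlgHom (f := γ) hunit
  have hσ (x : C) : σ (algebraMap _ _ x) = γ x := IsLocalization.lift_eq _ x
  refine ⟨σ, AlgHom.coe_ringHom_injective
    (IsLocalization.ringHom_ext q.primeCompl (RingHom.ext fun x ↦ ?_))⟩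
  change φ (σ (algebraMap _ _ x)) = algebraMap _ _ x
  rw [hσ, hγ]

/-- A morphism locally of finite presentation is smooth if it has the lifting property against
small extensions of local rings. -/
theorem smooth_of_hasLiftingProperty {X Y : Scheme.{u}} (f : X ⟶ Y) [LocallyOfFinitePresentation f]
    (H : ∀ (B S : Type u) [CommRing B] [IsLocalRing B] [CommRing S] [Nontrivial S] (φ : B →+* S),
      Function.Surjective φ → (∀ b ∈ maximalIdeal B, ∀ x ∈ RingHom.ker φ, b * x = 0) →
      HasLiftingProperty (Spec.map (CommRingCat.ofHom φ)) f) :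
    Smooth f where
  smooth_appLE {U} hU {V} hV e := by
    have := f.finitePresentation_appLE hU hV e
    algebraize [(f.appLE U V e).hom]
    refine ⟨Algebra.smoothLocus_eq_univ_iff.mp (Set.eq_univ_iff_forall.mpr fun q ↦ ?_), ‹_›⟩
    refine formallySmooth_localization_of_exists_section q.asIdeal fun B _ _ _ φ hφ hB ↦ ?_
    let S := Localization.AtPrime q.asIdeal
    have hloc : IsLocalHom φ.toRingHom := .of_surjective _ hφ
    have := H B S φ.toRingHom hφ hB
    let a : Spec (.of S) ⟶ X :=
      Spec.map (CommRingCat.ofHom (algebraMap Γ(X, V) S)) ≫ hV.fromSpec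
    let b : Spec (.of B) ⟶ Y :=
      Spec.map (CommRingCat.ofHom (algebraMap Γ(Y, U) B)) ≫ hU.fromSpec
    have sq : CommSq a (Spec.map (CommRingCat.ofHom φ.toRingHom)) f b := ⟨by
      rw [Category.assoc, ← hU.SpecMap_appLE_fromSpec f hV e, ← Spec.map_comp_assoc,
        ← Spec.map_comp_assoc]
      congr 2
      exact CommRingCat.hom_ext φ.comp_algebraMap.symm⟩
    -- The only open set containing the closed point of `Spec B` is the whole space.
    have hrange : Set.range sq.lift ⊆ Set.range hV.fromSpec := by
      rw [hV.range_fromSpec]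
      rintro _ ⟨x, rfl⟩
      have h₁ : sq.lift (closedPoint B) ∈ V := by
        have h₂ : Spec.map (CommRingCat.ofHom φ.toRingHom) (closedPoint S) = closedPoint B :=
          IsLocalRing.comap_closedPoint φ.toRingHom
        have h₃ : sq.lift (closedPoint B) = a (closedPoint S) := by
          rw [← h₂]; exact congr($(sq.fac_left) (closedPoint S))
        rw [h₃]
        have : a (closedPoint S) ∈ Set.range hV.fromSpec := ⟨_, rfl⟩
        rwa [hV.range_fromSpec] at this
      exact ((IsLocalRing.specializes_closedPoint x).map sq.lift.continuous).mem_open V.isOpen h₁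
    obtain ⟨γ, hγ⟩ := Spec.map_surjective (IsOpenImmersion.lift hV.fromSpec sq.lift hrange)
    have hγ' : Spec.map γ ≫ hV.fromSpec = sq.lift := by rw [hγ, IsOpenImmersion.lift_fac]
    have hγA : f.appLE U V e ≫ γ = CommRingCat.ofHom (algebraMap Γ(Y, U) B) := by
      rw [← Spec.map_inj, ← cancel_mono hU.fromSpec, Spec.map_comp, Category.assoc,
        hU.SpecMap_appLE_fromSpec f hV e, reassoc_of% hγ', sq.fac_right]
    have hγφ : γ ≫ CommRingCat.ofHom φ.toRingHom =
        CommRingCat.ofHom (algebraMap Γ(X, V) S) := by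
      rw [← Spec.map_inj, ← cancel_mono hV.fromSpec, Spec.map_comp, Category.assoc, hγ',
        sq.fac_left]
    exact exists_section_of_lift q.asIdeal φ hφ ⟨γ.hom, fun r ↦ congr($(hγA).hom r)⟩
      fun x ↦ congr($(hγφ).hom x)

end LocalCriterion

/-! ### Infinitesimal lifting for Weil restrictions -/

section WeilRestrictionInfinitesimal

open TensorProduct IsLocalRing

variable {k E : Type u} [CommRing k] [CommRing E] [Algebra k E] {Y Z : Over (Spec (.of E))}
  (W : WeilRestriction (Spec.map (CommRingCat.ofHom (algebraMap k E))) Y)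
  (W' : WeilRestriction (Spec.map (CommRingCat.ofHom (algebraMap k E))) Z) (g : Y ⟶ Z)

lemma ker_tensorProduct_map_id {R R' : Type u} [CommRing R] [CommRing R'] [Algebra k R]
    [Algebra k R'] (ψ : R →ₐ[k] R') (hψ : Function.Surjective ψ) :
    RingHom.ker (Algebra.TensorProduct.map ψ (AlgHom.id k E)).toRingHom =
      (RingHom.ker ψ.toRingHom).map (Algebra.TensorProduct.includeLeft : R →ₐ[k] R ⊗[k] E) :=
  Algebra.TensorProduct.rTensor_ker ψ hψ

lemma WeilRestriction.formallyUnramified_map_left [FormallyUnramified g.left] :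
    FormallyUnramified (W.map W' g).left := by
  refine .of_hom_ext _ fun R R' φ hφ hφ₂ a₁ a₂ h h' ↦ ?_
  obtain ⟨σ, hσ⟩ := Spec.map_surjective (a₁ ≫ W.obj.hom)
  have hσ₂ : Spec.map σ = a₂ ≫ W.obj.hom := by
    rw [hσ, ← Over.w (W.map W' g), reassoc_of% h']
  let : Algebra k R := σ.hom.toAlgebra
  let : Algebra k R' := (φ.hom.comp σ.hom).toAlgebra
  let ψ : R →ₐ[k] R' := { φ.hom with commutes' := fun _ ↦ rfl }
  let p₁ : Over.mk (Spec.map (CommRingCat.ofHom (algebraMap k R))) ⟶ W.obj := Over.homMk a₁ hσ.symm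
  let p₂ : Over.mk (Spec.map (CommRingCat.ofHom (algebraMap k R))) ⟶ W.obj :=
    Over.homMk a₂ hσ₂.symm
  let ι : Over.mk (Spec.map (CommRingCat.ofHom (algebraMap k R'))) ⟶
      Over.mk (Spec.map (CommRingCat.ofHom (algebraMap k R))) := Over.homMk (Spec.map φ) (by
        exact (Spec.map_comp _ _).symm)
  suffices p₁ = p₂ from congr($(this).left)
  have hp : ι ≫ p₁ = ι ≫ p₂ := Over.OverMorphism.ext h
  have hp' : p₁ ≫ W.map W' g = p₂ ≫ W.map W' g := Over.OverMorphism.ext h'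
  replace hp := congr((W.homEquiv _ $hp).left)
  replace hp' := congr((W'.homEquiv _ $hp').left)
  rw [homEquiv_comp, homEquiv_comp, Over.comp_left, Over.comp_left] at hp
  rw [homEquiv_comp_map, homEquiv_comp_map, Over.comp_left, Over.comp_left] at hp'
  apply (W.homEquiv _).injective
  ext1
  let e := pullbackMapSpecIso k E ψ
  have hsurj : Function.Surjective (Algebra.TensorProduct.map ψ (AlgHom.id k E)) :=
    Algebra.TensorProduct.map_surjective _ _ hφ Function.surjective_id
  have : IsClosedImmersion (Spec.map (CommRingCat.ofHom
    (Algebra.TensorProduct.map ψ (AlgHom.id k E)).toRingHom)) := .spec_of_surjective _ hsurj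
  have hnil :
      IsNilpotent (RingHom.ker (Algebra.TensorProduct.map ψ (AlgHom.id k E)).toRingHom) := by
    refine ⟨2, ?_⟩
    rw [ker_tensorProduct_map_id ψ hφ, ← Ideal.map_pow]
    erw [hφ₂]
    exact Ideal.map_bot
  rw [← cancel_epi e.inv.right]
  have hw (x : ((Over.pullback (Spec.map (CommRingCat.ofHom (algebraMap k E)))).obj
      (Over.mk (Spec.map (CommRingCat.ofHom (algebraMap k R))))).left ⟶ Y.left) :
      Spec.map (CommRingCat.ofHom (Algebra.TensorProduct.map ψ (AlgHom.id k E)).toRingHom) ≫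
        e.inv.right ≫ x = e.inv.left ≫ ((Over.pullback _).map ι).left ≫ x := by
    rw [← Category.assoc, ← Category.assoc]
    exact congr($(e.inv.w.symm) ≫ x)
  refine FormallyUnramified.hom_ext _ (isNilpotent_ker_specMap _ hnil) g.left ?_ ?_
  · erw [hw, hw, hp]
  · simp only [Category.assoc, hp']

/-- Lifting property of the Weil restriction of a smooth morphism against small extensions of local
rings. -/
lemma WeilRestriction.hasLiftingProperty_map_left_of_smooth [Module.Finite k E] [Smooth g.left]
    {B S : Type u} [CommRing B] [IsLocalRing B] [CommRing S] [Nontrivial S] (φ : B →+* S)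
    (hφ : Function.Surjective φ) (hB : ∀ b ∈ maximalIdeal B, ∀ x ∈ RingHom.ker φ, b * x = 0) :
    HasLiftingProperty (Spec.map (CommRingCat.ofHom φ)) (W.map W' g).left := by
  refine hasLiftingProperty_specMap_map_left W W' g φ fun _ _ ψ hψ ↦ ?_
  subst hψ
  have hker := ker_tensorProduct_map_id (E := E) ψ hφ
  refine hasLiftingProperty_of_smooth_of_finite (B := B) _
    (Algebra.TensorProduct.map_surjective _ _ hφ Function.surjective_id) ⟨2, ?_⟩ ?_ _
  · have h : RingHom.ker ψ.toRingHom ^ 2 = ⊥ := by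
      rw [pow_two, ← le_bot_iff, Ideal.mul_le]
      exact fun x hx y hy ↦ hB x (le_maximalIdeal (RingHom.ker_ne_top _) hx) y hy
    rw [hker, ← Ideal.map_pow, h, Ideal.map_bot, Ideal.zero_eq_bot]
  · intro b hb x hx
    rw [hker] at hx
    refine Submodule.span_induction (p := fun x _ ↦ b • x = 0) ?_ (smul_zero b)
      (fun x y _ _ hx hy ↦ by rw [smul_add, hx, hy, add_zero])
      (fun a x _ hx ↦ by rw [smul_comm, hx, smul_zero]) hx
    rintro _ ⟨y, hy, rfl⟩
    change b • (y ⊗ₜ[k] (1 : E)) = 0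
    rw [TensorProduct.smul_tmul', smul_eq_mul, hB b hb y hy, TensorProduct.zero_tmul]

end WeilRestrictionInfinitesimal

/-! ### Morphisms locally of finite presentation -/

section FinitePresentation

/-- A morphism out of a limit of affine schemes into the Weil restriction of `Y`, given over the
Weil restriction of `Z` at finite levels, factors through a finite level if `Y` is locally of finite
presentation over `Z`. -/
lemma WeilRestriction.exists_π_app_comp_eq {S T : Scheme.{u}} {h : T ⟶ S} [IsAffineHom h]
    {Y Z : Over T} (W : WeilRestriction h Y) (W' : WeilRestriction h Z) (g : Y ⟶ Z)
    [LocallyOfFinitePresentation g.left] {I : Type u} [SmallCategory I] [IsCofiltered I]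
    (D : I ⥤ Scheme.{u}) [∀ i, IsAffine (D.obj i)] (t : D ⟶ (Functor.const I).obj W'.obj.left)
    (c : Cone D) (hc : IsLimit c) (a : c.pt ⟶ W.obj.left)
    (ha : ∀ i, c.π.app i ≫ t.app i = a ≫ (W.map W' g).left) :
    ∃ (i : I) (b : D.obj i ⟶ W.obj.left),
      c.π.app i ≫ b = a ∧ b ≫ (W.map W' g).left = t.app i := by
  let s : D ⟶ (Functor.const I).obj S := t ≫ (Functor.const I).map W'.obj.hom
  have hs (i : I) : c.π.app i ≫ s.app i = a ≫ W.obj.hom := by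
    rw [← Over.w (W.map W' g), ← Category.assoc, ← ha i, Category.assoc]; rfl
  let D' := Over.lift D s
  let c' := Over.liftCone D s c _ hs
  have : Nonempty I := IsCofiltered.nonempty
  let hc' : IsLimit c' := Over.isLimitLiftCone D s c _ hs hc
  let G := Over.pullback h ⋙ Over.forget T
  have : IsConnected I := IsCofiltered.isConnected I
  let hGc : IsLimit (G.mapCone c') := isLimitOfPreserves G hc'
  let t' (i : I) : D'.obj i ⟶ W'.obj := Over.homMk (t.app i) rfl
  let a' : c'.pt ⟶ W.obj := Over.homMk a rfl
  let τ : D' ⋙ G ⟶ (Functor.const I).obj Z.left :=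
    { app i := (W'.homEquiv _ (t' i)).left
      naturality i j f := by
        have : t' i = D'.map f ≫ t' j := by
          ext1; exact ((t.naturality f).trans (Category.comp_id _)).symm
        rw [this, homEquiv_comp]
        exact (Category.comp_id _).symm }
  have haff (i : I) : IsAffine ((D' ⋙ G).obj i) := by
    have : IsAffine (D'.obj i).left := inferInstanceAs (IsAffine (D.obj i))
    let p : D.obj i ⟶ S := s.app i
    have : IsAffineHom (pullback.fst p h) :=
      MorphismProperty.of_isPullback (P := @IsAffineHom) (IsPullback.of_hasPullback p h).flip ‹_›
    exact @isAffine_of_isAffineHom _ _ _ this _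
  obtain ⟨i, b, hb, hb'⟩ := Scheme.exists_π_app_comp_eq_of_locallyOfFinitePresentation
    (D' ⋙ G) τ g.left _ hGc (W.homEquiv _ a').left (by
      ext i
      have : c'.π.app i ≫ t' i = a' ≫ W.map W' g := by ext1; exact ha i
      replace this := congr((W'.homEquiv _ $this).left)
      rw [homEquiv_comp, homEquiv_comp_map] at this
      exact this)
  let b' : (Over.pullback h).obj (D'.obj i) ⟶ Y := Over.homMk b (by
    rw [← Over.w g]
    exact (congr($hb' ≫ Z.hom)).trans (Over.w (W'.homEquiv _ (t' i))))
  have h₁ : c'.π.app i ≫ (W.homEquiv _).symm b' = a' := by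
    apply (W.homEquiv _).injective
    rw [homEquiv_comp, Equiv.apply_symm_apply]
    ext1
    exact hb
  have h₂ : (W.homEquiv _).symm b' ≫ W.map W' g = t' i := by
    apply (W'.homEquiv _).injective
    rw [homEquiv_comp_map, Equiv.apply_symm_apply]
    ext1
    exact hb'
  exact ⟨i, ((W.homEquiv _).symm b').left, congr($(h₁).left), congr($(h₂).left)⟩

variable {A C : Type u} [CommRing A] [CommRing C] [Algebra A C]

/-- Whenever the `A`-algebra `C` is the colimit of a directed system of `A`-algebras, the identity
of `C` factors through some member of the system. The colimit is expressed in `CommRingCat`, with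
the `A`-algebra structures given by `α`. -/
def SplitsOffDirectedColimits (A C : Type u) [CommRing A] [CommRing C] [Algebra A C] : Prop :=
  ∀ (J : Type u) [Preorder J] [IsDirectedOrder J] [Nonempty J] (F : J ⥤ CommRingCat.{u})
    (α : (Functor.const J).obj (CommRingCat.of A) ⟶ F)
    (ι : F ⟶ (Functor.const J).obj (CommRingCat.of C)),
    Nonempty (IsColimit (Cocone.mk _ ι)) →
    (∀ j, α.app j ≫ ι.app j = (CommRingCat.ofHom (algebraMap A C) : CommRingCat.of A ⟶ .of C)) →
    ∃ (j : J) (s : CommRingCat.of C ⟶ F.obj j),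
      s ≫ ι.app j = 𝟙 _ ∧ CommRingCat.ofHom (algebraMap A C) ≫ s = α.app j

/-- A cocone of rings over a directed order that is jointly surjective, and injective up to
transition maps, is a colimit. -/
lemma nonempty_isColimit_of_directed {J : Type u} [Preorder J] [IsDirectedOrder J] [Nonempty J]
    (F : J ⥤ CommRingCat.{u}) (c : Cocone F)
    (hsurj : ∀ x : c.pt, ∃ (i : J) (y : F.obj i), x = c.ι.app i y)
    (hinj : ∀ (i : J) (x y : F.obj i), c.ι.app i x = c.ι.app i y →
      ∃ (k : J) (f : i ⟶ k), F.map f x = F.map f y) : Nonempty (IsColimit c) := by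
  have hc : IsColimit ((forget CommRingCat).mapCocone c) :=
    Types.FilteredColimit.isColimitOf' _ _ hsurj hinj
  have : ReflectsColimit F (forget CommRingCat) := reflectsColimit_of_reflectsIsomorphisms _ _
  exact ⟨isColimitOfReflects (forget CommRingCat) hc⟩

/-- `C` is the union of its finitely generated subalgebras, so it equals one of them. -/
lemma SplitsOffDirectedColimits.finiteType (H : SplitsOffDirectedColimits A C) :
    Algebra.FiniteType A C := by
  let J := {S : Subalgebra A C // S.FG}
  have : IsDirectedOrder J := ⟨fun S S' ↦ ⟨⟨S.1 ⊔ S'.1, S.2.sup S'.2⟩, le_sup_left (a := S.1),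
    le_sup_right (a := S.1)⟩⟩
  have : Nonempty J := ⟨⟨⊥, Subalgebra.fg_bot⟩⟩
  let F : J ⥤ CommRingCat.{u} :=
    { obj S := .of S.1
      map f := CommRingCat.ofHom (Subalgebra.inclusion (leOfHom f)).toRingHom
      map_id _ := rfl
      map_comp _ _ := rfl }
  let α : (Functor.const J).obj (.of A) ⟶ F :=
    { app S := CommRingCat.ofHom (algebraMap A S.1)
      naturality _ _ _ := rfl }
  let ι : F ⟶ (Functor.const J).obj (.of C) :=
    { app S := CommRingCat.ofHom S.1.val.toRingHom
      naturality _ _ _ := rfl }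
  obtain ⟨S, s, hs, -⟩ := H J F α ι (nonempty_isColimit_of_directed _ _
    (fun x ↦ ⟨⟨Algebra.adjoin A {x}, ⟨{x}, by simp⟩⟩,
      ⟨x, Algebra.subset_adjoin rfl⟩, rfl⟩)
    (fun S x y h ↦ ⟨S, 𝟙 _, by rw [show x = y from Subtype.ext h]⟩)) fun _ ↦ rfl
  refine ⟨(eq_top_iff.mpr fun x _ ↦ ?_ : S.1 = ⊤) ▸ S.2⟩
  have : (s x).1 = x := congr($hs x)
  exact this ▸ (s x).2

/-- A finitely generated algebra `C = P / I` is the colimit of the `P / K` for `K ≤ I` finitely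
generated. If it splits off from `P / K`, then `K` and finitely many further elements generate
`I`. -/
lemma SplitsOffDirectedColimits.finitePresentation (H : SplitsOffDirectedColimits A C) :
    Algebra.FinitePresentation A C := by
  have := H.finiteType
  obtain ⟨n, f, hf⟩ := Algebra.FiniteType.iff_quotient_mvPolynomial''.1 this
  refine ⟨n, f, hf, ?_⟩
  let P := MvPolynomial (Fin n) A
  let I : Ideal P := RingHom.ker f.toRingHom
  let J := {K : Ideal P // K.FG ∧ K ≤ I}
  have : IsDirectedOrder J := ⟨fun S S' ↦ ⟨⟨S.1 ⊔ S'.1, Submodule.FG.sup S.2.1 S'.2.1,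
    sup_le S.2.2 S'.2.2⟩,
    le_sup_left (a := S.1), le_sup_right (a := S.1)⟩⟩
  have : Nonempty J := ⟨⟨⊥, Submodule.fg_bot, bot_le⟩⟩
  let F : J ⥤ CommRingCat.{u} :=
    { obj K := .of (P ⧸ K.1)
      map {K L} g := CommRingCat.ofHom (Ideal.Quotient.factor (leOfHom g : K.1 ≤ L.1))
      map_id K := by ext <;> rfl
      map_comp _ _ := by ext <;> rfl }
  let α : (Functor.const J).obj (.of A) ⟶ F :=
    { app K := CommRingCat.ofHom (algebraMap A (P ⧸ K.1))
      naturality _ _ _ := rfl }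
  let ι : F ⟶ (Functor.const J).obj (.of C) :=
    { app K := CommRingCat.ofHom (Ideal.Quotient.lift K.1 f.toRingHom fun x hx ↦ K.2.2 hx)
      naturality _ _ _ := by ext <;> rfl }
  obtain ⟨K, s, hs, hs'⟩ := H J F α ι (nonempty_isColimit_of_directed _ _
    (fun x ↦ by
      obtain ⟨y, rfl⟩ := hf x
      exact ⟨⟨⊥, Submodule.fg_bot, bot_le⟩, Ideal.Quotient.mk _ y, rfl⟩)
    (fun K x y h ↦ by
      obtain ⟨x, rfl⟩ := Ideal.Quotient.mk_surjective x
      obtain ⟨y, rfl⟩ := Ideal.Quotient.mk_surjective y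
      have hxy : x - y ∈ I := by
        rw [RingHom.mem_ker, map_sub, sub_eq_zero]; exact h
      let L : J := ⟨K.1 ⊔ Ideal.span {x - y}, Submodule.FG.sup K.2.1 ⟨{x - y}, by simp⟩,
        sup_le K.2.2 (by simpa [Ideal.span_le] using hxy)⟩
      refine ⟨L, homOfLE (le_sup_left (a := K.1)), ?_⟩
      exact Ideal.Quotient.eq.mpr (Ideal.mem_sup_right (Ideal.mem_span_singleton_self _))))
    fun K ↦ by
      ext x; exact f.commutes x
  let σ : C →ₐ[A] P ⧸ K.1 := { s.hom with commutes' := fun x ↦ congr(($hs').hom x) }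
  have hσ (y : P ⧸ K.1) (x : C) (h : y = σ x) : Ideal.Quotient.lift K.1 f.toRingHom
      (fun x hx ↦ K.2.2 hx) y = x := h ▸ congr($hs x)
  choose q hq using fun i ↦ Ideal.Quotient.mk_surjective (σ (f (MvPolynomial.X i)))
  -- The relations `X i = q i`, which hold in `C`, make the section `σ` inverse to `P ⧸ K → C`.
  let L : Ideal P := K.1 ⊔ Ideal.span (Set.range fun i ↦ MvPolynomial.X i - q i)
  have hL : L.FG := Submodule.FG.sup K.2.1 (Submodule.fg_span (Set.finite_range _))
  convert hL
  refine le_antisymm ?_ (sup_le K.2.2 ?_)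
  · have hKL : K.1 ≤ L := le_sup_left
    have key : (Ideal.Quotient.factorₐ A hKL).comp (σ.comp f) = Ideal.Quotient.mkₐ A L := by
      refine MvPolynomial.algHom_ext fun i ↦ ?_
      change Ideal.Quotient.factor hKL (σ (f (MvPolynomial.X i))) = _
      rw [← hq i]
      refine (Ideal.Quotient.eq.mpr ?_).symm
      exact Ideal.mem_sup_right (Ideal.subset_span ⟨i, rfl⟩)
    intro x hx
    rw [← Ideal.Quotient.eq_zero_iff_mem]
    have hx' : f x = 0 := hx
    have := congr($key x)
    simpa [hx'] using this.symm
  · rw [Ideal.span_le]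
    rintro _ ⟨i, rfl⟩
    change f _ = 0
    rw [map_sub, sub_eq_zero]
    exact (hσ _ _ (hq i)).symm

/-- A morphism is locally of finite presentation if morphisms to it out of limits of affine schemes
factor through a finite level. -/
theorem locallyOfFinitePresentation_of_exists_π_app_comp_eq {X Y : Scheme.{u}} (f : X ⟶ Y)
    (H : ∀ (I : Type u) [SmallCategory I] [IsCofiltered I] (D : I ⥤ Scheme.{u})
      [∀ i, IsAffine (D.obj i)] (t : D ⟶ (Functor.const I).obj Y) (c : Cone D) (_ : IsLimit c)
      (a : c.pt ⟶ X) (_ : ∀ i, c.π.app i ≫ t.app i = a ≫ f),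
      ∃ (i : I) (b : D.obj i ⟶ X), c.π.app i ≫ b = a ∧ b ≫ f = t.app i) :
    LocallyOfFinitePresentation f := by
  refine HasRingHomProperty.iff_appLE.mpr fun ⟨U, hU⟩ ⟨V, hV⟩ e ↦ ?_
  replace hU : IsAffineOpen U := hU
  replace hV : IsAffineOpen V := hV
  algebraize [(f.appLE U V e).hom]
  refine SplitsOffDirectedColimits.finitePresentation fun J _ _ _ F α ι ⟨hι⟩ hα ↦ ?_
  let D : Jᵒᵖ ⥤ Scheme.{u} := F.op ⋙ Scheme.Spec
  let c : Cone D := Scheme.Spec.mapCone (Cocone.mk _ ι).op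
  let hc : IsLimit c := isLimitOfPreserves Scheme.Spec hι.op
  have (i : Jᵒᵖ) : IsAffine (D.obj i) := inferInstanceAs (IsAffine (Spec (F.obj i.unop)))
  let t : D ⟶ (Functor.const Jᵒᵖ).obj Y :=
    { app j := Spec.map (α.app j.unop) ≫ hU.fromSpec
      naturality i j f := by
        have := α.naturality f.unop
        change 𝟙 _ ≫ _ = _ at this
        rw [Category.id_comp] at this
        change Spec.map (F.map f.unop) ≫ Spec.map _ ≫ _ = _ ≫ 𝟙 _
        rw [← Spec.map_comp_assoc, ← this, Category.comp_id] }
  obtain ⟨i, b, hb, hb'⟩ := H Jᵒᵖ D t c hc hV.fromSpec fun i ↦ by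
    change Spec.map (ι.app i.unop) ≫ Spec.map (α.app i.unop) ≫ _ = _
    rw [← Spec.map_comp_assoc, hα, ← IsAffineOpen.SpecMap_appLE_fromSpec f hU hV e]
    rfl
  -- The factorization `b` maps into `V` after passing to a further level `j`.
  obtain ⟨j, p, hj⟩ := exists_map_eq_top D c hc (b ⁻¹ᵁ V) (by
    rw [← Scheme.Hom.comp_preimage, hb]
    exact hV.fromSpec_preimage_self)
  have hrange : Set.range (D.map p ≫ b) ⊆ Set.range hV.fromSpec := by
    rw [hV.range_fromSpec]
    rintro _ ⟨x, rfl⟩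
    have : x ∈ D.map p ⁻¹ᵁ b ⁻¹ᵁ V := hj ▸ trivial
    exact this
  let b' : D.obj j ⟶ Spec (.of Γ(X, V)) := IsOpenImmersion.lift hV.fromSpec (D.map p ≫ b) hrange
  have hb₁ : b' ≫ hV.fromSpec = D.map p ≫ b := IsOpenImmersion.lift_fac _ _ _
  obtain ⟨s, hs⟩ := Spec.map_surjective (R := .of Γ(X, V)) (S := F.obj j.unop) b'
  refine ⟨j.unop, s, Spec.map_injective ?_, Spec.map_injective ?_⟩
  · rw [Spec.map_comp, hs, ← cancel_mono hV.fromSpec, Category.assoc, hb₁, Spec.map_id]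
    exact (Category.assoc _ _ _).symm.trans
      (congr($(c.w p) ≫ b).trans (hb.trans (Category.id_comp _).symm))
  · rw [Spec.map_comp, hs, ← cancel_mono hU.fromSpec, Category.assoc]
    have : Spec.map (CommRingCat.ofHom (algebraMap Γ(Y, U) Γ(X, V))) ≫ hU.fromSpec =
        hV.fromSpec ≫ f := IsAffineOpen.SpecMap_appLE_fromSpec f hU hV e
    rw [this, reassoc_of% hb₁, hb']
    exact (t.naturality p).trans (Category.comp_id _)

lemma WeilRestriction.locallyOfFinitePresentation_map_left {S T : Scheme.{u}} {h : T ⟶ S}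
    [IsAffineHom h] {Y Z : Over T} (W : WeilRestriction h Y) (W' : WeilRestriction h Z) (g : Y ⟶ Z)
    [LocallyOfFinitePresentation g.left] : LocallyOfFinitePresentation (W.map W' g).left :=
  locallyOfFinitePresentation_of_exists_π_app_comp_eq _ fun _ _ _ D _ t c hc a ha ↦
    W.exists_π_app_comp_eq W' g D t c hc a ha

end FinitePresentation

/-! ### Weil restrictions of smooth and étale morphisms -/

section SmoothEtale

variable {k E : Type u} [CommRing k] [CommRing E] [Algebra k E] [Module.Finite k E]
  {Y Z : Over (Spec (.of E))}
  (W : WeilRestriction (Spec.map (CommRingCat.ofHom (algebraMap k E))) Y)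
  (W' : WeilRestriction (Spec.map (CommRingCat.ofHom (algebraMap k E))) Z) (g : Y ⟶ Z)

theorem WeilRestriction.smooth_map_left [Smooth g.left] : Smooth (W.map W' g).left :=
  have := W.locallyOfFinitePresentation_map_left W' g
  smooth_of_hasLiftingProperty _ fun _ _ _ _ _ _ φ hφ hB ↦
    W.hasLiftingProperty_map_left_of_smooth W' g φ hφ hB

theorem WeilRestriction.etale_map_left [Etale g.left] : Etale (W.map W' g).left := by
  have := W.smooth_map_left W' g
  have := W.formallyUnramified_map_left W' g
  exact Etale.of_formallyUnramified_of_flat _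

end SmoothEtale

/-! ### Closed immersions -/

section ClosedImmersion

open TensorProduct

/-- The locus in `Spec D` where a morphism to `Z` factors through a closed subscheme `Y` of `Z` is
cut out by an ideal. -/
lemma exists_ideal_forall_factors_iff {Y Z : Scheme.{u}} (g : Y ⟶ Z) [IsClosedImmersion g]
    {D : Type u} [CommRing D] (z : Spec (.of D) ⟶ Z) :
    ∃ I : Ideal D, ∀ (C : Type u) [CommRing C] (χ : D →+* C),
      (∃ y : Spec (.of C) ⟶ Y, y ≫ g = Spec.map (CommRingCat.ofHom χ) ≫ z) ↔
        I ≤ RingHom.ker χ := by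
  obtain ⟨I, e, he⟩ := IsClosedImmersion.Spec_iff.mp
    (MorphismProperty.of_isPullback (P := @IsClosedImmersion) (IsPullback.of_hasPullback g z) ‹_›)
  refine ⟨I, fun C _ χ ↦ ⟨?_, fun h ↦ ?_⟩⟩
  · rintro ⟨y, hy⟩
    obtain ⟨ψ, hψ⟩ := Spec.map_surjective
      (pullback.lift y (Spec.map (CommRingCat.ofHom χ)) hy ≫ e.hom)
    have : Spec.map (CommRingCat.ofHom χ) =
        Spec.map (CommRingCat.ofHom (Ideal.Quotient.mk I) ≫ ψ) := by
      rw [Spec.map_comp, hψ, Category.assoc, ← he, pullback.lift_snd]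
    intro x hx
    have hχ := congr($(Spec.map_injective this) x)
    change χ x = ψ (Ideal.Quotient.mk I x) at hχ
    rw [RingHom.mem_ker, hχ, Ideal.Quotient.eq_zero_iff_mem.mpr hx, map_zero]
  · refine ⟨Spec.map (CommRingCat.ofHom (Ideal.Quotient.lift I χ h)) ≫ e.inv ≫ pullback.fst g z, ?_⟩
    have he' : e.inv ≫ pullback.snd g z = Spec.map (CommRingCat.ofHom (Ideal.Quotient.mk I)) := by
      rw [he, e.inv_hom_id_assoc]
    rw [Category.assoc, Category.assoc, pullback.condition, reassoc_of% he', ← Spec.map_comp_assoc,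
      ← CommRingCat.ofHom_comp]
    erw [Ideal.Quotient.lift_comp_mk]

/-- A monomorphism is a closed immersion if the locus where a map to its target factors through it
is cut out by an ideal. -/
lemma isClosedImmersion_of_forall_exists_ideal {X S : Scheme.{u}} (r : X ⟶ S) [Mono r]
    (H : ∀ (B : Type u) [CommRing B] (v : Spec (.of B) ⟶ S),
      ∃ I : Ideal B, ∀ (C : Type u) [CommRing C] (θ : B →+* C),
        (∃ x : Spec (.of C) ⟶ X, x ≫ r = Spec.map (CommRingCat.ofHom θ) ≫ v) ↔
          I ≤ RingHom.ker θ) :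
    IsClosedImmersion r := by
  refine IsZariskiLocalAtTarget.of_openCover (P := @IsClosedImmersion) S.affineCover fun i ↦ ?_
  let B := S.affineOpenCover.X i
  let v : Spec (.of B) ⟶ S := S.affineCover.f i
  change IsClosedImmersion (pullback.snd r v)
  obtain ⟨I, hI⟩ := H B v
  obtain ⟨x, hx⟩ := (hI _ (Ideal.Quotient.mk I)).mpr (Ideal.mk_ker).ge
  let ι := Spec.map (CommRingCat.ofHom (Ideal.Quotient.mk I))
  let σ := pullback.lift x ι hx
  have hσ : σ ≫ pullback.snd r v = ι := pullback.lift_snd _ _ _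
  let χ : B →+* Γ(pullback r v, ⊤) :=
    ((Scheme.ΓSpecIso (.of B)).inv ≫ (pullback.snd r v).appTop).hom
  have hχ : (pullback r v).toSpecΓ ≫ Spec.map (CommRingCat.ofHom χ) = pullback.snd r v := by
    change _ ≫ Spec.map ((Scheme.ΓSpecIso (.of B)).inv ≫ (pullback.snd r v).appTop) = _
    rw [Spec.map_comp, ← Scheme.toSpecΓ_naturality_assoc, toSpecΓ_SpecMap_ΓSpecIso_inv,
      Category.comp_id]
  -- An element of `Γ(X ×_S Spec B)` is zero if it vanishes on affine open subschemes, to which the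
  -- hypothesis applies.
  have hIχ : I ≤ RingHom.ker χ := by
    intro b hb
    refine Scheme.zero_of_zero_cover (χ b) (pullback r v).affineCover fun j ↦ ?_
    let f : Spec _ ⟶ pullback r v := (pullback r v).affineCover.f j
    obtain ⟨θ, hθ⟩ := Spec.map_surjective (f ≫ pullback.snd r v)
    have hbθ : θ b = 0 := (hI _ θ.hom).mp ⟨f ≫ pullback.fst r v, by
      rw [Category.assoc, pullback.condition, ← Category.assoc, ← hθ]; rfl⟩ hb
    have key : (Scheme.ΓSpecIso (.of B)).inv ≫ (pullback.snd r v).appTop ≫ f.appTop =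
        θ ≫ (Scheme.ΓSpecIso _).inv := by
      rw [← Scheme.Hom.comp_appTop, ← hθ, ← Scheme.ΓSpecIso_inv_naturality]
    refine congr($key b).trans ?_
    change (Scheme.ΓSpecIso _).inv (θ b) = 0
    rw [hbθ, map_zero]
  let τ : pullback r v ⟶ Spec (.of (B ⧸ I)) :=
    (pullback r v).toSpecΓ ≫ Spec.map (CommRingCat.ofHom (Ideal.Quotient.lift I χ hIχ))
  have hτ : τ ≫ ι = pullback.snd r v := by
    rw [Category.assoc, ← Spec.map_comp, ← CommRingCat.ofHom_comp]
    erw [Ideal.Quotient.lift_comp_mk]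
    exact hχ
  have : IsClosedImmersion ι := .spec_of_surjective _ Ideal.Quotient.mk_surjective
  refine IsClosedImmersion.Spec_iff.mpr ⟨I, ⟨τ, σ, ?_, ?_⟩, hτ.symm⟩
  · rw [← cancel_mono (pullback.snd r v), Category.assoc, hσ, hτ, Category.id_comp]
  · rw [← cancel_mono ι, Category.assoc, hτ, hσ, Category.id_comp]

/-- If `E` is free over `k`, the vanishing of an ideal of `B ⊗ E` after base change to a
`B`-algebra is governed by the ideal of `B` generated by the coordinates of its elements. -/
lemma exists_ideal_le_ker_tensorProduct_map_iff {k E B : Type u} [CommRing k] [CommRing E]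
    [Algebra k E] [Module.Free k E] [CommRing B] [Algebra k B] (I : Ideal (B ⊗[k] E)) :
    ∃ J : Ideal B, ∀ (C : Type u) [CommRing C] [Algebra k C] (θ : B →ₐ[k] C),
      I ≤ RingHom.ker (Algebra.TensorProduct.map θ (AlgHom.id k E)).toRingHom ↔
        J ≤ RingHom.ker θ.toRingHom := by
  let b := Module.Free.chooseBasis k E
  refine ⟨Ideal.span {y | ∃ x ∈ I, ∃ i, (Algebra.TensorProduct.basis B b).repr x i = y},
    fun C _ _ θ ↦ ?_⟩
  have key (x : B ⊗[k] E) (i) : (Algebra.TensorProduct.basis C b).repr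
      (Algebra.TensorProduct.map θ (AlgHom.id k E) x) i =
        θ ((Algebra.TensorProduct.basis B b).repr x i) := by
    induction x with
    | zero => simp
    | add x y hx hy => simp [hx, hy]
    | tmul x y => simp
  rw [Ideal.span_le]
  constructor
  · rintro h _ ⟨x, hx, i, rfl⟩
    change θ _ = 0
    rw [← key, show Algebra.TensorProduct.map θ (AlgHom.id k E) x = 0 from h hx]
    simp
  · intro h x hx
    change Algebra.TensorProduct.map θ (AlgHom.id k E) x = 0
    refine (Algebra.TensorProduct.basis C b).repr.injective (Finsupp.ext fun i ↦ ?_)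
    rw [key, map_zero]
    exact h ⟨x, hx, i, rfl⟩

variable {k E : Type u} [CommRing k] [CommRing E] [Algebra k E] [Module.Free k E]
  {Y Z : Over (Spec (.of E))}
  (W : WeilRestriction (Spec.map (CommRingCat.ofHom (algebraMap k E))) Y)
  (W' : WeilRestriction (Spec.map (CommRingCat.ofHom (algebraMap k E))) Z) (g : Y ⟶ Z)

theorem WeilRestriction.isClosedImmersion_map_left [IsClosedImmersion g.left] :
    IsClosedImmersion (W.map W' g).left := by
  have : Mono g := Over.mono_of_mono_left g
  have : Mono (W.map W' g) := ⟨fun p q hpq ↦ (W.homEquiv _).injective <| by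
    rw [← cancel_mono g, ← homEquiv_comp_map, hpq, homEquiv_comp_map]⟩
  refine isClosedImmersion_of_forall_exists_ideal _ fun B _ v ↦ ?_
  obtain ⟨σ, hσ⟩ := Spec.map_surjective (v ≫ W'.obj.hom)
  let : Algebra k B := σ.hom.toAlgebra
  let v' : Over.mk (Spec.map (CommRingCat.ofHom (algebraMap k B))) ⟶ W'.obj := Over.homMk v hσ.symm
  obtain ⟨I, hI⟩ := exists_ideal_forall_factors_iff g.left
    ((pullbackSpecIso k B E).inv ≫ (W'.homEquiv _ v').left)
  obtain ⟨J, hJ⟩ := exists_ideal_le_ker_tensorProduct_map_iff I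
  refine ⟨J, fun C _ θ ↦ ?_⟩
  let : Algebra k C := (θ.comp σ.hom).toAlgebra
  let ψ : B →ₐ[k] C := { θ with commutes' := fun _ ↦ rfl }
  let ι : Over.mk (Spec.map (CommRingCat.ofHom (algebraMap k C))) ⟶
      Over.mk (Spec.map (CommRingCat.ofHom (algebraMap k B))) :=
    Over.homMk (Spec.map (CommRingCat.ofHom θ)) (by exact (Spec.map_comp _ _).symm)
  let e := pullbackMapSpecIso k E ψ
  have he : ((Over.pullback (Spec.map (CommRingCat.ofHom (algebraMap k E)))).map ι).left =
      (pullbackSpecIso k C E).hom ≫ Spec.map (CommRingCat.ofHom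
        (Algebra.TensorProduct.map ψ (AlgHom.id k E)).toRingHom) ≫ (pullbackSpecIso k B E).inv := by
    rw [← Category.assoc, Iso.eq_comp_inv]
    exact e.hom.w.symm
  refine Iff.trans ?_ ((hI _ (Algebra.TensorProduct.map ψ (AlgHom.id k E)).toRingHom).trans
    (hJ C ψ))
  constructor
  · rintro ⟨x, hx⟩
    let x' : Over.mk (Spec.map (CommRingCat.ofHom (algebraMap k C))) ⟶ W.obj := Over.homMk x (by
      rw [← Over.w (W.map W' g), reassoc_of% hx, ← hσ]
      exact (Spec.map_comp _ _).symm)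
    have hx' : x' ≫ W.map W' g = ι ≫ v' := by ext1; exact hx
    replace hx' := congr((W'.homEquiv _ $hx').left)
    rw [homEquiv_comp_map, homEquiv_comp, Over.comp_left, Over.comp_left, he] at hx'
    refine ⟨(pullbackSpecIso k C E).inv ≫ (W.homEquiv _ x').left, ?_⟩
    rw [Category.assoc]
    erw [hx']
    simp
  · rintro ⟨y, hy⟩
    let y' : (Over.pullback (Spec.map (CommRingCat.ofHom (algebraMap k E)))).obj
      (Over.mk (Spec.map (CommRingCat.ofHom (algebraMap k C)))) ⟶ Y :=
        Over.homMk ((pullbackSpecIso k C E).hom ≫ y) (by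
          have h := Over.w ((Over.pullback _).map ι ≫ W'.homEquiv _ v')
          rw [Over.comp_left, he] at h
          rw [← h, ← Over.w g, Category.assoc, reassoc_of% hy]
          simp only [Category.assoc])
    have h₁ : y' ≫ g = W'.homEquiv _ (ι ≫ v') := by
      rw [homEquiv_comp]
      ext1
      rw [Over.comp_left, Over.comp_left, he]
      simp [y', hy]
    have h₂ : (W.homEquiv _).symm y' ≫ W.map W' g = ι ≫ v' := by
      apply (W'.homEquiv _).injective
      rw [homEquiv_comp_map, Equiv.apply_symm_apply, h₁]
    exact ⟨((W.homEquiv _).symm y').left, congr($(h₂).left)⟩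

end ClosedImmersion

/-! ### Points of a finite free algebra scheme -/

section Points

variable {A : Type u} [CommRing A] (𝓔 : FiniteFreeAlgebraScheme A) (k : Type u) [CommRing k]
  [Algebra A k]

/-- The trivialisation `ψ` on `k`-points, as a `k`-linear isomorphism `𝓔(k) ≃ k^ℓ`. -/
noncomputable def FiniteFreeAlgebraScheme.pointsEquiv :
    letI := (𝓔.standardMap k).toAlgebra
    𝓔.Points k ≃ₗ[k] (Fin 𝓔.ℓ → k) :=
  letI := (𝓔.standardMap k).toAlgebra
  let γ : (specOver A k ⟶ standardRingScheme (Spec (.of A))) ≃+* k :=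
    (standardPoints (specOver A k)).trans (Scheme.ΓSpecIso (.of k)).commRingCatIsoToRingEquiv
  LinearEquiv.ofBijective (M := 𝓔.Points k)
    { toFun (x : specOver A k ⟶ 𝓔.E) i := γ (x ≫ 𝓔.ψ.hom ≫ Pi.π _ i)
      map_add' x y := funext fun i ↦ by
        refine (congrArg γ (𝓔.ψ_add _ _ i)).trans (map_add γ _ _)
      map_smul' c x := funext fun i ↦ by
        refine (congrArg γ (𝓔.ψ_smul (γ.symm c) x i)).trans ((map_mul γ _ _).trans ?_)
        rw [γ.apply_symm_apply]
        rfl }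
    ⟨fun (x y : specOver A k ⟶ 𝓔.E) hxy ↦ by
      have h (i) := γ.injective (congrFun hxy i)
      refine (cancel_mono 𝓔.ψ.hom).mp (Pi.hom_ext _ _ fun i ↦ ?_)
      rw [Category.assoc, Category.assoc]
      exact h i,
    fun c ↦ ⟨show specOver A k ⟶ 𝓔.E from Pi.lift (fun i ↦ γ.symm (c i)) ≫ 𝓔.ψ.inv,
      funext fun i ↦ by
        change γ ((Pi.lift (fun i ↦ γ.symm (c i)) ≫ 𝓔.ψ.inv) ≫ 𝓔.ψ.hom ≫ Pi.π _ i) = c i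
        simp⟩⟩

end Points

/-! ### Prolongation spaces -/

section Terminal

variable {S T : Scheme.{u}} (h : T ⟶ S)

/-- The Weil restriction of a terminal object is terminal. -/
noncomputable def WeilRestriction.ofIsTerminal {Z : Over T} (hZ : IsTerminal Z) :
    WeilRestriction h Z where
  obj := Over.mk (𝟙 S)
  r := hZ.from _
  bijective U := ⟨fun _ _ _ ↦ Over.mkIdTerminal.hom_ext _ _, fun _ ↦
    ⟨Over.mkIdTerminal.from U, hZ.hom_ext _ _⟩⟩

end Terminal

end ERing

theorem mainTheorem6 {A : Type u} [CommRing A] (𝓔 : ERing.FiniteFreeAlgebraScheme A)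
    {k : Type u} [CommRing k] [Algebra A k] (e : k →ₐ[A] 𝓔.Points k) :
    (∀ (X Y : Over (Spec (.of k))) (f : X ⟶ Y)
      (τX : ERing.Prolongation 𝓔 e X) (τY : ERing.Prolongation 𝓔 e Y),
      (Etale f.left → Etale (ERing.Prolongation.map τX τY f).left) ∧
      (IsClosedImmersion f.left →
        IsClosedImmersion (ERing.Prolongation.map τX τY f).left) ∧
      (Smooth f.left → Smooth (ERing.Prolongation.map τX τY f).left)) ∧
    (∀ (X : Over (Spec (.of k))) (τX : ERing.Prolongation 𝓔 e X),
      Smooth X.hom → Smooth τX.obj.hom) := by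
  let := (𝓔.standardMap k).toAlgebra
  have : Module.Free k (𝓔.Points k) := .of_equiv (𝓔.pointsEquiv k).symm
  have : Module.Finite k (𝓔.Points k) := .equiv (𝓔.pointsEquiv k).symm
  have smooth (X Y : Over (Spec (.of k))) (f : X ⟶ Y) (τX : ERing.Prolongation 𝓔 e X)
      (τY : ERing.Prolongation 𝓔 e Y) (hf : Smooth f.left) :
      Smooth (ERing.Prolongation.map τX τY f).left := by
    have : Smooth ((Over.pullback (ERing.exponentialSpec 𝓔 e)).map f).left :=
      MorphismProperty.overPullbackMap _ _ hf
    exact ERing.WeilRestriction.smooth_map_left (k := k) (E := 𝓔.Points k) τX τY _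
  refine ⟨fun X Y f τX τY ↦ ⟨fun hf ↦ ?_, fun hf ↦ ?_, smooth X Y f τX τY⟩, fun X τX hX ↦ ?_⟩
  · have : Etale ((Over.pullback (ERing.exponentialSpec 𝓔 e)).map f).left :=
      MorphismProperty.overPullbackMap _ _ hf
    exact ERing.WeilRestriction.etale_map_left (k := k) (E := 𝓔.Points k) τX τY _
  · have : IsClosedImmersion ((Over.pullback (ERing.exponentialSpec 𝓔 e)).map f).left :=
      MorphismProperty.overPullbackMap _ _ hf
    exact ERing.WeilRestriction.isClosedImmersion_map_left (k := k) (E := 𝓔.Points k) τX τY _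
  · -- The prolongation space of `Spec k` is `Spec k`.
    let τ : ERing.Prolongation 𝓔 e (Over.mk (𝟙 (Spec (.of k)))) := .ofIsTerminal _
      (Over.mkIdTerminal.isTerminalObj (Over.pullback (ERing.exponentialSpec 𝓔 e)) _)
    have h := smooth X (Over.mk (𝟙 _)) (Over.mkIdTerminal.from X) τX τ (by
      have : (Over.mkIdTerminal.from X).left = X.hom := by
        exact (Category.comp_id _).symm.trans (Over.w (Over.mkIdTerminal.from X))
      rwa [this])
    have : (ERing.Prolongation.map τX τ (Over.mkIdTerminal.from X)).left = τX.obj.hom := by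
      exact (Category.comp_id _).symm.trans
        (Over.w (ERing.Prolongation.map τX τ (Over.mkIdTerminal.from X)))
    rwa [this] at h
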